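/- For every $n\in\mathbb N$ let $C_n$ be a quantum circuit on $N(n)$ qubits, acting on the all-zeroes basis state, with the following five rounds. Round 1: Hadamard gates are applied to the qubits in a set $A_n$. Round 2: a basis-preserving unitary operation $|x\rangle\mapsto\gamma_n(x)\,|\pi_n(x)\rangle$ is applied, where $\pi_n$ is a permutation of $\{0,1\}^{N(n)}$ and $\gamma_n(x)\in\mathbb C$. Round 3: Hadamard gates are applied to the qubits in a set $S_n$. Round 4: the qubits in $S_n$ are measured in the computational basis, with outcome $u\in\{0,1\}^{S_n}$. Round 5: the bit $g_n(u)$ is computed classically and output, where $g_n:\{0,1\}^{S_n}\to\{0,1\}$ is a Boolean function. Assume that the family is uniform and efficient: there are deterministic classical algorithms that compute in time polynomial in $n$ the sets $A_n$ and $S_n$ (as subsets of the $N(n)$ qubits), the strings $\pi_n(x)$ and $\pi_n^{-1}(x)$ from $n$ and $x$, and the bit $g_n(u)$ from $n$ and $u$; and one that computes the real and the imaginary part of $\gamma_n(x)$ from $n$, $m$ and $x$ up to an error of $2^{-m}$ in time polynomial in $n+m$. Assume further that $g_n$ is promised to be sparse: there is a polynomial $s$ such that, for every $n$, at most $s(n)$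 of the Fourier coefficients $$\hat g_n(u)=\sum_{x\in\{0,1\}^{S_n}}(-1)^{u^Tx+g_n(x)},\qquad u\in\{0,1\}^{S_n},$$ are nonzero. (Nothing else about the Fourier spectrum is assumed to be known.) Then the circuits can be simulated efficiently classically. That is, let $E_n=\sum_u \mathrm{Prob}_n(u)\,(-1)^{g_n(u)}$ be the expectation value of $Z$ on the output bit of $C_n$, where $\mathrm{Prob}_n$ is the distribution of the measurement outcome. For all polynomials $p$ and $r$ with coefficients in $\mathbb N$ there is a randomized classical algorithm that, on input $n$, runs in time polynomial in $n$, uses polynomially many uniform random bits, and outputs a rational number $c$ with $|c-E_n|\le 1/(p(n)+1)$ with probability at least $1-2^{-r(n)}$. -/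

import Mathlib

namespace QSim

/-! ### The classical model of computation

Programs of a small first-order functional language act on values that are built from natural
numbers by pairing.  Every elementary operation is charged one step plus the bit size of the value
it acts on, so that every charged computation can be carried out on a multitape Turing machine in
time polynomial in its cost, and every Turing machine can be simulated step by step at polynomial
cost. Hence polynomial time in this model is polynomial time in the usual sense. -/

/-- Data: natural numbers (stored in binary) and pairs. -/
inductive Val : Type
  | num (k : ℕ) : Val
  | pair (a b : Val) : Val

namespace Val

/-- The number of bits needed to store a value (up to a constant factor). -/
def size : Val → ℕ
  | num k => Nat.size k + 1
  | pair a b => a.size + b.size + 1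

/-- First component; the number `0` on a value that is not a pair. -/
def fst : Val → Val
  | pair a _ => a
  | num _ => num 0

/-- Second component; the number `0` on a value that is not a pair. -/
def snd : Val → Val
  | pair _ b => b
  | num _ => num 0

/-- Apply a binary operation to a pair of numbers; the number `0` on all other values. -/
def arith (op : ℕ → ℕ → ℕ) : Val → Val
  | pair (num a) (num b) => num (op a b)
  | _ => num 0

/-- Lists as iterated pairs that end in the number `0`. -/
def ofList : List Val → Val
  | [] => num 0
  | a :: l => pair a (ofList l)

/-- The encoding of a bit string. -/
def ofBits {N : ℕ} (x : Fin N → Bool) : Val :=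
  ofList (List.ofFn fun i => num (x i).toNat)

/-- The value `v` denotes the rational number `q`: it is a triple `((a, b), d)` of natural numbers
with `d > 0` and `q = (a - b) / d`. -/
def IsRat (v : Val) (q : ℚ) : Prop :=
  ∃ a b d : ℕ, 0 < d ∧ v = pair (pair (num a) (num b)) (num d) ∧ q = ((a : ℚ) - b) / d

end Val

/-- The arithmetic operations: addition, truncated subtraction, multiplication, and
integer division (with `a / 0 = 0`). -/
inductive Op : Type
  | add | sub | mul | div

/-- The function on natural numbers that an arithmetic operation computes. -/
def Op.toFun : Op → ℕ → ℕ → ℕ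
  | add => fun a b => a + b
  | sub => fun a b => a - b
  | mul => fun a b => a * b
  | div => fun a b => a / b

/-- Programs. -/
inductive Prog : Type
  | id : Prog
  | const (v : Val) : Prog
  | fst : Prog
  | snd : Prog
  | arith (op : Op) : Prog
  | pair (f g : Prog) : Prog
  | comp (g f : Prog) : Prog
  | ite (c f g : Prog) : Prog
  | loop (c f : Prog) : Prog

/-- `Runs c x y t`: on input `x` the program `c` halts with output `y` after exactly `t` steps.
`comp g f` runs `f` and then `g`; `ite c f g` runs `f` if the test `c` returns a value different
from the number `0`, and `g` otherwise; `loop c f` repeats `f` as long as the test `c` returns a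
value different from the number `0`. -/
inductive Runs : Prog → Val → Val → ℕ → Prop
  | id (x : Val) : Runs Prog.id x x (x.size + 1)
  | const (v x : Val) : Runs (Prog.const v) x v (x.size + 1)
  | fst (x : Val) : Runs Prog.fst x x.fst (x.size + 1)
  | snd (x : Val) : Runs Prog.snd x x.snd (x.size + 1)
  | arith (op : Op) (x : Val) : Runs (Prog.arith op) x (x.arith op.toFun) (x.size + 1)
  | pair {f g : Prog} {x y z : Val} {s t : ℕ} :
      Runs f x y s → Runs g x z t → Runs (Prog.pair f g) x (Val.pair y z) (s + t + 1)
  | comp {f g : Prog} {x y z : Val} {s t : ℕ} :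
      Runs f x y s → Runs g y z t → Runs (Prog.comp g f) x z (s + t + 1)
  | ite_true {c f g : Prog} {x v y : Val} {s t : ℕ} :
      Runs c x v s → v ≠ Val.num 0 → Runs f x y t → Runs (Prog.ite c f g) x y (s + t + 1)
  | ite_false {c f g : Prog} {x y : Val} {s t : ℕ} :
      Runs c x (Val.num 0) s → Runs g x y t → Runs (Prog.ite c f g) x y (s + t + 1)
  | loop_stop {c f : Prog} {x : Val} {s : ℕ} :
      Runs c x (Val.num 0) s → Runs (Prog.loop c f) x x (s + 1)
  | loop_step {c f : Prog} {x v y z : Val} {s t r : ℕ} :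
      Runs c x v s → v ≠ Val.num 0 → Runs f x y t → Runs (Prog.loop c f) y z r →
        Runs (Prog.loop c f) x z (s + t + r + 1)

/-- A single program solves all the instances `i : ι` deterministically: on input `inp i` it halts
after at most polynomially many steps in the size parameter `par i`, with an output that
satisfies `good i`. -/
def PolyTime {ι : Type} (par : ι → ℕ) (inp : ι → Val) (good : ι → Val → Prop) : Prop :=
  ∃ (c : Prog) (T : Polynomial ℕ), ∀ i, ∃ (v : Val) (t : ℕ),
    Runs c (inp i) v t ∧ t ≤ T.eval (par i) ∧ good i v

/-- The real numbers `E 0, E 1, …` can be approximated efficiently with polynomial accuracy,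
with probability exponentially close to one: for all polynomials `p` and `r` there is a randomized
polynomial-time algorithm that outputs, on input `n`, a rational number within distance
`1 / (p n + 1)` of `E n` with probability at least `1 - 2 ^ (-r n)`. The algorithm is a program
that is given a string `ω` of polynomially many independent uniform random bits. -/
def PolyApproximable (E : ℕ → ℝ) : Prop :=
  ∀ p r : Polynomial ℕ, ∃ (c : Prog) (T ℓ : Polynomial ℕ), ∀ n : ℕ,
    ∃ out : (Fin (ℓ.eval n) → Bool) → ℚ,
      (∀ ω, ∃ (v : Val) (t : ℕ),
        Runs c (Val.pair (Val.num n) (Val.ofBits ω)) v t ∧ t ≤ T.eval n ∧ v.IsRat (out ω)) ∧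
      1 - (1 / 2 : ℝ) ^ r.eval n ≤
        (Set.ncard {ω | |(out ω : ℝ) - E n| ≤ 1 / (((p.eval n : ℕ) : ℝ) + 1)} : ℝ) / 2 ^ ℓ.eval n

/-! ### Fourier coefficients of Boolean functions -/

/-- The Fourier coefficient `∑ x, (-1) ^ (u ⬝ x + g x)` of a Boolean function. -/
noncomputable def fourierCoeff {ι : Type} [Fintype ι] [DecidableEq ι]
    (g : (ι → Bool) → Bool) (u : ι → Bool) : ℝ :=
  ∑ x : ι → Bool, (-1 : ℝ) ^ ((∑ i, (u i && x i).toNat) + (g x).toNat)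

/-- The number of nonzero Fourier coefficients of a Boolean function. -/
noncomputable def sparseness {ι : Type} [Fintype ι] [DecidableEq ι]
    (g : (ι → Bool) → Bool) : ℕ :=
  Set.ncard {u | fourierCoeff g u ≠ 0}

/-! ### Five-round quantum circuits -/

/-- The Hadamard gate. -/
noncomputable def hadamard : Matrix Bool Bool ℂ :=
  fun a b => (1 / (Real.sqrt 2 : ℂ)) * (if a && b then -1 else 1)

/-- The operator on `N` qubits that applies a Hadamard gate to every qubit in `A` and the identity
to the other qubits, as a tensor product. -/
noncomputable def hadamardOn {N : ℕ} (A : Finset (Fin N)) :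
    Matrix (Fin N → Bool) (Fin N → Bool) ℂ :=
  fun x y => ∏ i, (if i ∈ A then hadamard else 1) (x i) (y i)

/-- The basis-preserving operator `|x⟩ ↦ γ x • |π x⟩`. -/
def basisPreserving {N : ℕ} (π : Equiv.Perm (Fin N → Bool)) (γ : (Fin N → Bool) → ℂ) :
    Matrix (Fin N → Bool) (Fin N → Bool) ℂ :=
  fun y x => if y = π x then γ x else 0

/-- A circuit on `N` qubits with five rounds: Hadamard gates on the qubits in `A`, the
basis-preserving unitary `|x⟩ ↦ γ x • |π x⟩`, Hadamard gates on the qubits in `S`, measurement of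
the qubits in `S` in the computational basis, and the evaluation of the Boolean function `g` on
the string of outcomes. -/
structure FiveRound (N : ℕ) where
  A : Finset (Fin N)
  π : Equiv.Perm (Fin N → Bool)
  γ : (Fin N → Bool) → ℂ
  unitary : basisPreserving π γ ∈ Matrix.unitaryGroup (Fin N → Bool) ℂ
  S : Finset (Fin N)
  g : (S → Bool) → Bool

namespace FiveRound

variable {N : ℕ} (C : FiveRound N)

/-- The state after the first three rounds, on the all-zeroes input. -/
noncomputable def finalState : (Fin N → Bool) → ℂ :=
  Matrix.mulVec (hadamardOn C.S)
    (Matrix.mulVec (basisPreserving C.π C.γ)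
      (Matrix.mulVec (hadamardOn C.A) (Pi.single (fun _ => false) 1)))

/-- The probability that the measurement of the qubits in `S` yields the bit string `u`. -/
noncomputable def prob (u : C.S → Bool) : ℝ :=
  ∑ x : Fin N → Bool, if (fun i : C.S => x i) = u then ‖C.finalState x‖ ^ 2 else 0

/-- The expectation value of `(-1) ^ g u`, that is, the expectation value of the Pauli operator `Z`
on the output bit. -/
noncomputable def expectation : ℝ :=
  ∑ u : C.S → Bool, C.prob u * (-1) ^ (C.g u).toNat

/-- A string of measurement outcomes as a string of `N` bits, with zeros outside `S`. -/
def extend (u : C.S → Bool) : Fin N → Bool :=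
  fun i => if h : i ∈ C.S then u ⟨i, h⟩ else false

end FiveRound

/-- The circuits `C 0, C 1, …` form a uniform family of efficient circuits: in time polynomial in
`n` one can determine (the number of qubits and) the sets `A` and `S`, the strings `π x` and
`π⁻¹ x`, and the bit `g u`, and in time polynomial in `n` and `m` one can determine the real and
the imaginary part of the coefficient `γ x` up to `2 ^ (-m)`. -/
structure Efficient {N : ℕ → ℕ} (C : ∀ n, FiveRound (N n)) : Prop where
  first : PolyTime (ι := ℕ) (fun n => n) (fun n => Val.num n)
    (fun n v => v = Val.ofBits (fun i => decide (i ∈ (C n).A)))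
  second : PolyTime (ι := ℕ) (fun n => n) (fun n => Val.num n)
    (fun n v => v = Val.ofBits (fun i => decide (i ∈ (C n).S)))
  perm : PolyTime (ι := Σ n, Fin (N n) → Bool) (fun i => i.1)
    (fun i => Val.pair (Val.num i.1) (Val.ofBits i.2))
    (fun i v => v = Val.ofBits ((C i.1).π i.2))
  perm_symm : PolyTime (ι := Σ n, Fin (N n) → Bool) (fun i => i.1)
    (fun i => Val.pair (Val.num i.1) (Val.ofBits i.2))
    (fun i v => v = Val.ofBits ((C i.1).π.symm i.2))
  phase : PolyTime (ι := ℕ × Σ n, Fin (N n) → Bool) (fun i => i.2.1 + i.1)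
    (fun i => Val.pair (Val.num i.2.1) (Val.pair (Val.num i.1) (Val.ofBits i.2.2)))
    (fun i v => ∃ (a b : Val) (p q : ℚ), v = Val.pair a b ∧ a.IsRat p ∧ b.IsRat q ∧
      |((C i.2.1).γ i.2.2).re - p| ≤ (1 / 2 : ℝ) ^ i.1 ∧
      |((C i.2.1).γ i.2.2).im - q| ≤ (1 / 2 : ℝ) ^ i.1)
  post : PolyTime (ι := Σ n, (C n).S → Bool) (fun i => i.1)
    (fun i => Val.pair (Val.num i.1) (Val.ofBits ((C i.1).extend i.2)))
    (fun i v => v = Val.num ((C i.1).g i.2).toNat)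

end QSim

/-!
The expectation value of the output sign is a sum over Fourier coefficients. Let `f = (-1) ^ g`,
as a function of all the `N` bits, have the normalized Fourier coefficients `f̂ v`. A diagonal
Pauli operator `Z ^ v` on the qubits in `S` becomes the bit flip `X ^ v` when it is moved through
the Hadamard gates of the third round, so that `E = ∑ v, f̂ v * ⟨ψ, X ^ v ψ⟩`, where `ψ` is the
state after the second round (`FiveRound.expectation_eq_sum`). Since `ψ` is a uniform
superposition of the basis states `π x` with the phases `γ x`, where `x` vanishes outside `A`, the
overlap `⟨ψ, X ^ v ψ⟩` is the expectation value of the bounded random variable `overlapTerm` of a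
random bit string. The coefficients `f̂ v` are also such expectation values, and so are the
weights `∑ f̂ v ^ 2` over all the `v` that agree with a given string from bit number `c` on
(`FiveRound.sum_weightTerm`). The last ones drive the search of Kushilevitz and Mansour for the
large Fourier coefficients: the candidates for the last bits of `v` are extended bit by bit, and
those of negligible weight are dropped. As a candidate of positive weight is the end of some `v`
with `f̂ v ≠ 0`, the lists of candidates stay as short as `f` is sparse (`candidates_spec`). The
sparseness also bounds the contribution to `E` of the coefficients that are not found.

All the averages are taken over the same random table. By a Chernoff bound and a union bound over
all the (exponentially many) averages that might be requested, the table is accurate for all of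
them simultaneously with high probability (`FiveRound.card_not_accurate_le`). The correctness of
the algorithm on an accurate table is then a deterministic statement
(`FiveRound.abs_estimate_sub_expectation_le`), with no need to treat adaptively chosen queries.

The running time is treated by a small calculus for the predicate `Feasible`: families of values
that one program computes from given inputs in polynomial time are closed under arithmetic,
branching, and loops with a counter (`Feasible.countdown`), hence under sums, list comprehensions,
and the operations on bit strings that the algorithm needs. Running times bound the sizes of
inputs and outputs, so the sizes of intermediate results rarely have to be estimated.
-/

namespace QSim

/-! ### Running times and output sizes -/

theorem eval_mono (T : Polynomial ℕ) : Monotone fun n => T.eval n := by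
  intro a b hab
  simp only [Polynomial.eval_eq_sum_range]
  gcongr

/-- The function `f` is bounded by a polynomial in the size parameter `par`. -/
def PolyBounded {ι : Type} (par f : ι → ℕ) : Prop :=
  ∃ B : Polynomial ℕ, ∀ i, f i ≤ B.eval (par i)

namespace PolyBounded

variable {ι κ : Type} {par f g : ι → ℕ}

theorem const (par : ι → ℕ) (a : ℕ) : PolyBounded par fun _ => a :=
  ⟨Polynomial.C a, fun i => by simp⟩

theorem self (par : ι → ℕ) : PolyBounded par par := ⟨Polynomial.X, fun i => by simp⟩

theorem mono (hg : PolyBounded par g) (h : ∀ i, f i ≤ g i) : PolyBounded par f :=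
  hg.imp fun _ hB i => (h i).trans (hB i)

theorem add (hf : PolyBounded par f) (hg : PolyBounded par g) :
    PolyBounded par fun i => f i + g i := by
  obtain ⟨A, hA⟩ := hf
  obtain ⟨B, hB⟩ := hg
  exact ⟨A + B, fun i => by simpa using add_le_add (hA i) (hB i)⟩

theorem mul (hf : PolyBounded par f) (hg : PolyBounded par g) :
    PolyBounded par fun i => f i * g i := by
  obtain ⟨A, hA⟩ := hf
  obtain ⟨B, hB⟩ := hg
  exact ⟨A * B, fun i => by simpa using Nat.mul_le_mul (hA i) (hB i)⟩

theorem eval (hf : PolyBounded par f) (T : Polynomial ℕ) :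
    PolyBounded par fun i => T.eval (f i) := by
  obtain ⟨A, hA⟩ := hf
  exact ⟨T.comp A, fun i => by simpa using eval_mono T (hA i)⟩

theorem comp (hf : PolyBounded par f) (e : κ → ι) :
    PolyBounded (fun k => par (e k)) fun k => f (e k) :=
  hf.imp fun _ hB k => hB (e k)

end PolyBounded

theorem size_pos (x : Val) : 0 < x.size := by
  cases x <;> simp [Val.size]

theorem Runs.size_lt {c : Prog} {x y : Val} {t : ℕ} (h : Runs c x y t) : x.size < t := by
  induction h <;> omega

/-- The total size of the constants in a program. -/
def Prog.constSize : Prog → ℕ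
  | .const v => v.size
  | .pair f g => f.constSize + g.constSize
  | .comp f g => f.constSize + g.constSize
  | .ite c f g => c.constSize + f.constSize + g.constSize
  | .loop c f => c.constSize + f.constSize
  | _ => 0

theorem natSize_op_le (op : Op) (a b : ℕ) :
    Nat.size (op.toFun a b) ≤ Nat.size a + Nat.size b + 1 := by
  have ha := Nat.lt_size_self a
  have hb := Nat.lt_size_self b
  have h1 : (1 : ℕ) ≤ 2 ^ Nat.size a := Nat.one_le_two_pow
  have h2 : (1 : ℕ) ≤ 2 ^ Nat.size b := Nat.one_le_two_pow
  rw [Nat.size_le, pow_succ, pow_add]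
  cases op <;> simp only [Op.toFun]
  · nlinarith
  · have := Nat.sub_le a b
    nlinarith
  · nlinarith [Nat.mul_le_mul ha.le hb.le, Nat.mul_le_mul h1 h2]
  · have := Nat.div_le_self a b
    nlinarith

theorem size_arith_le (op : Op) (x : Val) : (x.arith op.toFun).size ≤ x.size + 1 := by
  unfold Val.arith
  split
  · next a b =>
    have := natSize_op_le op a b
    simp only [Val.size]
    omega
  · have := size_pos x
    simp [Val.size]

/-- A program cannot write more than its running time allows, apart from its constants. -/
theorem Runs.size_le {c : Prog} {x y : Val} {t : ℕ} (h : Runs c x y t) :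
    y.size ≤ t + c.constSize := by
  induction h with
  | id x => omega
  | const v x => simp [Prog.constSize]
  | fst x => cases x <;> simp [Val.fst, Val.size] <;> omega
  | snd x => cases x <;> simp [Val.snd, Val.size] <;> omega
  | arith op x => have := size_arith_le op x; omega
  | pair _ _ h1 h2 => simp only [Val.size, Prog.constSize]; omega
  | comp _ _ h1 h2 => simp only [Prog.constSize]; omega
  | ite_true _ _ _ h1 h2 => simp only [Prog.constSize]; omega
  | ite_false _ _ h1 h2 => simp only [Prog.constSize]; omega
  | loop_stop h1 => have := h1.size_lt; omega
  | loop_step _ _ _ _ h1 h2 h3 => omega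

/-! ### Families of values that are computable in polynomial time -/

/-- A single program computes, for every `i`, the value `out i` from the value `inp i` in time
polynomial in `par i`. -/
def Feasible {ι : Type} (par : ι → ℕ) (inp out : ι → Val) : Prop :=
  PolyTime par inp fun i v => v = out i

/-- A relation that is solved in polynomial time has a feasible choice of solutions. -/
theorem PolyTime.exists_feasible {ι : Type} {par : ι → ℕ} {inp : ι → Val} {good : ι → Val → Prop}
    (h : PolyTime par inp good) : ∃ out, Feasible par inp out ∧ ∀ i, good i (out i) := by
  obtain ⟨c, T, h⟩ := h
  choose v t h1 h2 h3 using h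
  exact ⟨v, ⟨c, T, fun i => ⟨v i, t i, h1 i, h2 i, rfl⟩⟩, h3⟩

/-- The input `ctx k` gives access to everything that can be computed from the input `inp (e k)`.
The combinators for loops below quantify over all such inputs of the loop body, so that no
particular layout of the memory is visible to their users. -/
def Extends {ι κ : Type} (par : ι → ℕ) (inp : ι → Val) (e : κ → ι) (ctx : κ → Val) : Prop :=
  ∀ ⦃f : ι → Val⦄, Feasible par inp f → Feasible (fun k => par (e k)) ctx fun k => f (e k)

theorem Extends.bounded_counter {ι : Type} {par k : ι → ℕ} {inp : ι → Val}
    {ctx : (Σ i, Fin (k i)) → Val} (_ : Extends par inp Sigma.fst ctx) (hK : PolyBounded par k) :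
    PolyBounded (fun x : Σ i, Fin (k i) => par x.1) fun x => x.2 :=
  (hK.comp Sigma.fst).mono fun x => x.2.2.le

namespace Feasible

variable {ι κ : Type} {par : ι → ℕ} {inp f g h : ι → Val}

theorem iff_runs : Feasible par inp f ↔
    ∃ (c : Prog) (T : Polynomial ℕ), ∀ i, ∃ t, Runs c (inp i) (f i) t ∧ t ≤ T.eval (par i) := by
  refine exists_congr fun c => exists_congr fun T => forall_congr' fun i => ?_
  constructor
  · rintro ⟨v, t, h1, h2, rfl⟩
    exact ⟨t, h1, h2⟩
  · rintro ⟨t, h1, h2⟩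
    exact ⟨_, t, h1, h2, rfl⟩

theorem of_runs (c : Prog) (t : ι → ℕ) (hc : ∀ i, Runs c (inp i) (f i) (t i))
    (ht : PolyBounded par t) : Feasible par inp f := by
  obtain ⟨T, hT⟩ := ht
  exact iff_runs.2 ⟨c, T, fun i => ⟨t i, hc i, hT i⟩⟩

theorem exists_runs (hf : Feasible par inp f) :
    ∃ (c : Prog) (t : ι → ℕ), (∀ i, Runs c (inp i) (f i) (t i)) ∧ PolyBounded par t := by
  obtain ⟨c, T, h⟩ := iff_runs.1 hf
  choose t h1 h2 using h
  exact ⟨c, t, h1, T, h2⟩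

/-- Every step is charged for the size of the value it acts on, so that the running time bounds the
size of the input. -/
theorem bounded_inp (hf : Feasible par inp f) : PolyBounded par fun i => (inp i).size := by
  obtain ⟨c, t, hc, ht⟩ := hf.exists_runs
  exact ht.mono fun i => (hc i).size_lt.le

theorem bounded (hf : Feasible par inp f) : PolyBounded par fun i => (f i).size := by
  obtain ⟨c, t, hc, ht⟩ := hf.exists_runs
  exact (ht.add (.const _ c.constSize)).mono fun i => (hc i).size_le

theorem reindex (hf : Feasible par inp f) (e : κ → ι) :
    Feasible (fun k => par (e k)) (fun k => inp (e k)) fun k => f (e k) := by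
  obtain ⟨c, t, hc, ht⟩ := hf.exists_runs
  exact of_runs c (fun k => t (e k)) (fun k => hc (e k)) (ht.comp e)

theorem change_par (hf : Feasible par inp f) {par' : ι → ℕ} (hp : PolyBounded par' par) :
    Feasible par' inp f := by
  obtain ⟨c, T, h⟩ := iff_runs.1 hf
  choose t h1 h2 using h
  exact of_runs c t h1 ((hp.eval T).mono h2)

theorem input (hb : PolyBounded par fun i => (inp i).size) : Feasible par inp inp :=
  of_runs .id _ (fun _ => .id _) (hb.add (.const _ 1))

theorem comp (hf : Feasible par inp f) (hg : Feasible par f g) : Feasible par inp g := by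
  obtain ⟨c, t, hc, ht⟩ := hf.exists_runs
  obtain ⟨d, s, hd, hs⟩ := hg.exists_runs
  exact of_runs (.comp d c) _ (fun i => .comp (hc i) (hd i)) ((ht.add hs).add (.const _ 1))

theorem pair (hf : Feasible par inp f) (hg : Feasible par inp g) :
    Feasible par inp fun i => .pair (f i) (g i) := by
  obtain ⟨c, t, hc, ht⟩ := hf.exists_runs
  obtain ⟨d, s, hd, hs⟩ := hg.exists_runs
  exact of_runs (.pair c d) _ (fun i => .pair (hc i) (hd i)) ((ht.add hs).add (.const _ 1))

/-- Constants are feasible; the hypothesis only serves to bound the size of the input. -/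
theorem const (hf : Feasible par inp f) (v : Val) : Feasible par inp fun _ => v :=
  of_runs (.const v) _ (fun _ => .const v _) (hf.bounded_inp.add (.const _ 1))

theorem fst (hf : Feasible par inp f) : Feasible par inp fun i => (f i).fst :=
  hf.comp (of_runs .fst _ (fun _ => .fst _) (hf.bounded.add (.const _ 1)))

theorem snd (hf : Feasible par inp f) : Feasible par inp fun i => (f i).snd :=
  hf.comp (of_runs .snd _ (fun _ => .snd _) (hf.bounded.add (.const _ 1)))

theorem arith (op : Op) {a b : ι → ℕ} (ha : Feasible par inp fun i => .num (a i))
    (hb : Feasible par inp fun i => .num (b i)) :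
    Feasible par inp fun i => .num (op.toFun (a i) (b i)) :=
  (ha.pair hb).comp (of_runs (.arith op) _ (fun _ => .arith op _)
    ((ha.pair hb).bounded.add (.const _ 1)))

/-- Branching; both branches have to be feasible for all the inputs. -/
theorem ite {c : ι → Bool} (hc : Feasible par inp fun i => .num (c i).toNat)
    (hf : Feasible par inp f) (hg : Feasible par inp g) :
    Feasible par inp fun i => if c i then f i else g i := by
  obtain ⟨d, t, hd, ht⟩ := hc.exists_runs
  obtain ⟨p, s, hp, hs⟩ := hf.exists_runs
  obtain ⟨q, r, hq, hr⟩ := hg.exists_runs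
  refine of_runs (.ite d p q) (fun i => if c i then t i + s i + 1 else t i + r i + 1) (fun i => ?_)
    ((((ht.add hs).add hr).add (.const _ 1)).mono fun i => ?_)
  · have hd := hd i
    cases hci : c i
    · rw [hci] at hd
      exact .ite_false hd (hq i)
    · rw [hci] at hd
      exact .ite_true hd (by simp) (hp i)
  · split <;> omega

variable {a b : ι → ℕ}

theorem add (ha : Feasible par inp fun i => .num (a i))
    (hb : Feasible par inp fun i => .num (b i)) :
    Feasible par inp fun i => .num (a i + b i) := ha.arith .add hb

theorem sub (ha : Feasible par inp fun i => .num (a i))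
    (hb : Feasible par inp fun i => .num (b i)) :
    Feasible par inp fun i => .num (a i - b i) := ha.arith .sub hb

theorem mul (ha : Feasible par inp fun i => .num (a i))
    (hb : Feasible par inp fun i => .num (b i)) :
    Feasible par inp fun i => .num (a i * b i) := ha.arith .mul hb

theorem div (ha : Feasible par inp fun i => .num (a i))
    (hb : Feasible par inp fun i => .num (b i)) :
    Feasible par inp fun i => .num (a i / b i) := ha.arith .div hb

theorem natConst (hf : Feasible par inp f) (m : ℕ) : Feasible par inp fun _ => .num m :=
  hf.const (.num m)

theorem eval (T : Polynomial ℕ) (ha : Feasible par inp fun i => .num (a i)) :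
    Feasible par inp fun i => .num (T.eval (a i)) := by
  induction T using Polynomial.induction_on with
  | C m => simpa using ha.natConst m
  | add p q hp hq => simpa using hp.add hq
  | monomial m c hm => simpa [pow_succ, ← mul_assoc] using hm.mul ha

theorem of_bool_eq {c d : ι → Bool} (hc : Feasible par inp fun i => .num (c i).toNat)
    (hcd : ∀ i, c i = d i) : Feasible par inp fun i => .num (d i).toNat := by
  rwa [← funext hcd]

theorem lt (ha : Feasible par inp fun i => .num (a i))
    (hb : Feasible par inp fun i => .num (b i)) :
    Feasible par inp fun i => .num (decide (a i < b i)).toNat := by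
  -- `1 - (1 - (b - a))` is the indicator of `a < b` in truncated subtraction
  have := (ha.natConst 1).sub ((ha.natConst 1).sub (hb.sub ha))
  refine cast (congrArg _ (funext fun i => ?_)) this
  by_cases hi : a i < b i <;> simp [hi] <;> omega

theorem not {c : ι → Bool} (hc : Feasible par inp fun i => .num (c i).toNat) :
    Feasible par inp fun i => .num (!c i).toNat := by
  refine cast (congrArg _ (funext fun i => ?_)) ((hc.natConst 1).sub hc)
  cases c i <;> rfl

theorem and {c d : ι → Bool} (hc : Feasible par inp fun i => .num (c i).toNat)
    (hd : Feasible par inp fun i => .num (d i).toNat) :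
    Feasible par inp fun i => .num (c i && d i).toNat := by
  refine cast (congrArg _ (funext fun i => ?_)) (hc.mul hd)
  cases c i <;> cases d i <;> rfl

theorem xor {c d : ι → Bool} (hc : Feasible par inp fun i => .num (c i).toNat)
    (hd : Feasible par inp fun i => .num (d i).toNat) :
    Feasible par inp fun i => .num (c i ^^ d i).toNat := by
  refine cast (congrArg _ (funext fun i => ?_)) (hc.ite hd.not hd)
  cases c i <;> cases d i <;> rfl

theorem le (ha : Feasible par inp fun i => .num (a i))
    (hb : Feasible par inp fun i => .num (b i)) :
    Feasible par inp fun i => .num (decide (a i ≤ b i)).toNat :=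
  (hb.lt ha).not.of_bool_eq fun i => by
    by_cases hi : a i ≤ b i <;> simp [hi]; omega

/-! ### Loops -/

/-- A `while` loop runs in polynomial time if the number of rounds and the size of all the
intermediate states are bounded polynomially and one round is feasible. The states are numbered
backwards, and the loop is controlled by the first component of the state. -/
theorem loop {k : ι → ℕ} {st : ι → ℕ → Val} (hk : PolyBounded par k)
    (hB : ∃ B : Polynomial ℕ, ∀ i j, j ≤ k i → (st i j).size ≤ B.eval (par i))
    (hfst : ∀ i, (st i 0).fst = .num 0)
    (hfst' : ∀ i j, j < k i → (st i (j + 1)).fst ≠ .num 0)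
    (hs : Feasible (ι := Σ i, Fin (k i)) (fun x => par x.1) (fun x => st x.1 (x.2 + 1))
      (fun x => st x.1 x.2)) :
    Feasible par (fun i => st i (k i)) (fun i => st i 0) := by
  obtain ⟨K, hK⟩ := hk
  obtain ⟨B, hB⟩ := hB
  obtain ⟨c, T, hc⟩ := iff_runs.1 hs
  have key : ∀ i j, j ≤ k i → ∃ t, Runs (.loop .fst c) (st i j) (st i 0) t ∧
      t ≤ j * (B.eval (par i) + 2 + T.eval (par i)) + (B.eval (par i) + 2) := by
    intro i j
    induction j with
    | zero =>
      intro hj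
      have := Runs.fst (st i 0)
      rw [hfst i] at this
      refine ⟨_, Runs.loop_stop this, ?_⟩
      have := hB i 0 hj
      omega
    | succ j ih =>
      intro hj
      obtain ⟨t, ht, ht'⟩ := ih (by omega)
      obtain ⟨s, hs, hs'⟩ := hc ⟨i, ⟨j, hj⟩⟩
      have := Runs.fst (st i (j + 1))
      refine ⟨_, .loop_step this (hfst' i j hj) hs ht, ?_⟩
      have := hB i _ hj
      dsimp only at hs'
      rw [add_mul]
      omega
  refine iff_runs.2 ⟨.loop .fst c, K * (B + 2 + T) + (B + 2), fun i => ?_⟩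
  obtain ⟨t, ht, ht'⟩ := key i (k i) le_rfl
  refine ⟨t, ht, ht'.trans ?_⟩
  simp only [Polynomial.eval_add, Polynomial.eval_mul, Polynomial.eval_ofNat]
  gcongr
  exact hK i

/-- A loop with a counter `j` that counts from `k i` down to `0`: the state `st i j` is computed
from `st i (j + 1)`, and the loop body may use `j` and everything that is feasible from the input
of the loop. -/
theorem countdown {k : ι → ℕ} {st : ι → ℕ → Val}
    (hk : Feasible par inp fun i => .num (k i)) (hK : PolyBounded par k)
    (hB : ∃ B : Polynomial ℕ, ∀ i j, j ≤ k i → (st i j).size ≤ B.eval (par i))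
    (h0 : Feasible par inp fun i => st i (k i))
    (hs : ∀ ctx : (Σ i, Fin (k i)) → Val, Extends par inp Sigma.fst ctx →
      Feasible (fun x => par x.1) ctx (fun x => .num x.2) →
      Feasible (fun x => par x.1) ctx (fun x => st x.1 (x.2 + 1)) →
      Feasible (fun x => par x.1) ctx (fun x => st x.1 x.2)) :
    Feasible par inp fun i => st i 0 := by
  obtain ⟨B, hB⟩ := hB
  obtain ⟨K, hK'⟩ := hK
  obtain ⟨I, hI⟩ := hk.bounded_inp
  have hid : Feasible par inp inp := input ⟨I, hI⟩
  -- the memory holds the counter, the state, and the input of the loop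
  let st' : ι → ℕ → Val := fun i j => .pair (.num j) (.pair (st i j) (inp i))
  have hB' : ∃ B : Polynomial ℕ, ∀ i j, j ≤ k i → (st' i j).size ≤ B.eval (par i) := by
    refine ⟨K + B + I + 3, fun i j hj => ?_⟩
    have h1 := hB i j hj
    have h2 := hI i
    have h3 := hK' i
    have h4 : Nat.size j ≤ j := Nat.size_le.2 Nat.lt_two_pow_self
    simp only [st', Val.size, Polynomial.eval_add, Polynomial.eval_ofNat] at h2 ⊢
    omega
  have hin : PolyBounded (fun x : Σ i, Fin (k i) => par x.1)
      (fun x => (st' x.1 (x.2 + 1)).size) := by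
    obtain ⟨B', hB'⟩ := hB'
    exact ⟨B', fun x => hB' x.1 _ x.2.2⟩
  have hctx := input hin
  have hinp : Feasible (fun x : Σ i, Fin (k i) => par x.1) (fun x => st' x.1 (x.2 + 1))
      (fun x => inp x.1) := hctx.snd.snd
  have hnum : Feasible (fun x : Σ i, Fin (k i) => par x.1) (fun x => st' x.1 (x.2 + 1))
      (fun x => .num x.2) :=
    Feasible.sub (a := fun x : Σ i, Fin (k i) => x.2 + 1) hctx.fst (hctx.natConst 1)
  have hstep := hs _ (fun f hf => hinp.comp (hf.reindex Sigma.fst)) hnum hctx.snd.fst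
  exact ((hk.pair (h0.pair hid)).comp
    (loop (st := st') ⟨K, hK'⟩ hB' (fun _ => rfl) (by simp [st', Val.fst])
      (hnum.pair (hstep.pair hinp)))).snd.fst

/-- There is an input for a loop body with a loop variable below `k i`. It serves to bound the size
of the values that a loop body computes, before the loop is set up. -/
theorem exists_extends {k : ι → ℕ} (hf : Feasible par inp f) (hK : PolyBounded par k) :
    ∃ ctx : (Σ i, Fin (k i)) → Val, Extends par inp Sigma.fst ctx ∧
      Feasible (fun x => par x.1) ctx fun x => .num x.2 := by
  have hctx : Feasible (fun x : Σ i, Fin (k i) => par x.1)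
      (fun x => .pair (.num x.2) (inp x.1)) (fun x => .pair (.num x.2) (inp x.1)) := by
    refine input (((hK.add hf.bounded_inp).add (.const _ 2)).comp Sigma.fst |>.mono fun x => ?_)
    have h4 : Nat.size x.2 ≤ x.2 := Nat.size_le.2 Nat.lt_two_pow_self
    have := x.2.2
    simp only [Val.size]
    omega
  exact ⟨_, fun g hg => hctx.snd.comp (hg.reindex Sigma.fst), hctx.fst⟩

end Feasible

/-! ### Lists -/

theorem ofList_fst (l : List Val) : (Val.ofList l).fst = l.headD (.num 0) := by
  cases l <;> rfl

theorem ofList_snd (l : List Val) : (Val.ofList l).snd = .ofList l.tail := by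
  cases l <;> rfl

theorem size_ofList (l : List Val) :
    (Val.ofList l).size = (l.map fun v => v.size + 1).sum + 1 := by
  induction l with
  | nil => simp [Val.ofList, Val.size]
  | cons v l ih => simp [Val.ofList, Val.size, ih]; omega

theorem size_ofList_drop_le (l : List Val) (k : ℕ) :
    (Val.ofList (l.drop k)).size ≤ (Val.ofList l).size := by
  rw [size_ofList, size_ofList]
  gcongr
  exact ((List.drop_sublist k l).map _).sum_le_sum (by simp)

theorem length_lt_size_ofList (l : List Val) : l.length < (Val.ofList l).size := by
  induction l with
  | nil => simp [Val.ofList, Val.size]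
  | cons v l ih =>
    have := size_pos v
    simp only [Val.ofList, Val.size, List.length_cons]
    omega

namespace Feasible

variable {ι : Type} {par : ι → ℕ} {inp : ι → Val}

/-- Access to a list entry, with the default value `0`. The index has to be bounded, because the
program removes the preceding entries one by one. -/
theorem getList {l : ι → List Val} {k : ι → ℕ} (hl : Feasible par inp fun i => .ofList (l i))
    (hk : Feasible par inp fun i => .num (k i)) (hK : PolyBounded par k) :
    Feasible par inp fun i => (l i).getD (k i) (.num 0) := by
  obtain ⟨B, hB⟩ := hl.bounded
  have := countdown (st := fun i j => .ofList ((l i).drop (k i - j))) hk hK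
    ⟨B, fun i j _ => (size_ofList_drop_le _ _).trans (hB i)⟩ (by simpa using hl) ?_
  · refine cast (congrArg _ (funext fun i => ?_)) this.fst
    simp [ofList_fst, List.headD_eq_head?_getD, List.getD_eq_getElem?_getD]
  · intro ctx _ _ hst
    refine cast (congrArg _ (funext fun x => ?_)) hst.snd
    rw [ofList_snd, List.tail_drop]
    congr 2
    have := x.2.2
    omega

/-- List comprehension: the list of the values `F i j` for the `j < k i` that satisfy `c i j`. -/
theorem comprehension {k : ι → ℕ} {c : ι → ℕ → Bool} {F : ι → ℕ → Val}
    (hk : Feasible par inp fun i => .num (k i)) (hK : PolyBounded par k)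
    (hc : ∀ ctx : (Σ i, Fin (k i)) → Val, Extends par inp Sigma.fst ctx →
      Feasible (fun x => par x.1) ctx (fun x => .num x.2) →
      Feasible (fun x => par x.1) ctx (fun x => .num (c x.1 x.2).toNat))
    (hF : ∀ ctx : (Σ i, Fin (k i)) → Val, Extends par inp Sigma.fst ctx →
      Feasible (fun x => par x.1) ctx (fun x => .num x.2) →
      Feasible (fun x => par x.1) ctx (fun x => F x.1 x.2)) :
    Feasible par inp fun i => .ofList (((List.range (k i)).filter (c i)).map (F i)) := by
  obtain ⟨ctx, h1, h2⟩ := exists_extends hk hK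
  obtain ⟨B, hB⟩ := (hF ctx h1 h2).bounded
  obtain ⟨K, hK'⟩ := hK
  have := countdown
    (st := fun i j => .ofList (((List.range' j (k i - j)).filter (c i)).map (F i))) hk ⟨K, hK'⟩
    ⟨K * (B + 1) + 1, fun i j hj => ?_⟩ (by simpa [Val.ofList] using hk.natConst 0) ?_
  · simpa [List.range_eq_range'] using this
  · have hlen : ((List.range' j (k i - j)).filter (c i)).length ≤ K.eval (par i) :=
      (List.length_filter_le _ _).trans (by
        have := hK' i
        simp only [List.length_range']
        omega)
    rw [size_ofList, List.map_map]
    have : (((List.range' j (k i - j)).filter (c i)).map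
        ((fun v : Val => v.size + 1) ∘ F i)).sum ≤
        ((List.range' j (k i - j)).filter (c i)).length • (B.eval (par i) + 1) := by
      refine (List.sum_le_card_nsmul _ (B.eval (par i) + 1) fun m hm => ?_).trans (by simp)
      simp only [List.mem_map, List.mem_filter, List.mem_range'_1] at hm
      obtain ⟨a, ha, rfl⟩ := hm
      have := hB ⟨i, a, by omega⟩
      dsimp only [Function.comp] at this ⊢
      omega
    simp only [Polynomial.eval_add, Polynomial.eval_mul, Polynomial.eval_one, smul_eq_mul]
      at this ⊢
    exact add_le_add (this.trans (Nat.mul_le_mul hlen le_rfl)) le_rfl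
  · intro ctx he hj hst
    refine cast (congrArg _ (funext fun x => ?_)) ((hc ctx he hj).ite ((hF ctx he hj).pair hst) hst)
    have hx : k x.1 - x.2 = (k x.1 - (x.2 + 1)) + 1 := by
      have := x.2.2
      omega
    rw [hx, List.range'_succ, List.filter_cons]
    split <;> rfl

theorem map_range {k : ι → ℕ} {F : ι → ℕ → Val}
    (hk : Feasible par inp fun i => .num (k i)) (hK : PolyBounded par k)
    (hF : ∀ ctx : (Σ i, Fin (k i)) → Val, Extends par inp Sigma.fst ctx →
      Feasible (fun x => par x.1) ctx (fun x => .num x.2) →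
      Feasible (fun x => par x.1) ctx (fun x => F x.1 x.2)) :
    Feasible par inp fun i => .ofList ((List.range (k i)).map (F i)) := by
  have := comprehension (c := fun _ _ => true) hk hK
    (fun ctx he hj => hj.natConst 1) hF
  simpa using this

/-- The length of a list. No bound for a counter is at hand here, and the loop is controlled by the
list that is still to be read. -/
theorem length {l : ι → List Val} (hl : Feasible par inp fun i => .ofList (l i)) :
    Feasible par inp fun i => .num (l i).length := by
  have hb : PolyBounded par fun i => (l i).length :=
    hl.bounded.mono fun i => (length_lt_size_ofList _).le
  let st : ι → ℕ → Val := fun i j =>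
    .pair (.ofList ((l i).drop ((l i).length - j))) (.num ((l i).length - j))
  have hB : ∃ B : Polynomial ℕ, ∀ i j, j ≤ (l i).length → (st i j).size ≤ B.eval (par i) := by
    obtain ⟨B, hB⟩ := (hl.bounded.add hb).add (.const _ 2)
    refine ⟨B, fun i j hj => le_trans ?_ (hB i)⟩
    have h1 := size_ofList_drop_le (l i) ((l i).length - j)
    have h2 : Nat.size ((l i).length - j) ≤ (l i).length - j := Nat.size_le.2 Nat.lt_two_pow_self
    simp only [st, Val.size]
    omega
  have hin : PolyBounded (fun x : Σ i, Fin (l i).length => par x.1)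
      (fun x => (st x.1 (x.2 + 1)).size) := by
    obtain ⟨B, hB⟩ := hB
    exact ⟨B, fun x => hB x.1 _ x.2.2⟩
  have hctx := input hin
  have hnum : Feasible (fun x : Σ i, Fin (l i).length => par x.1) (fun x => st x.1 (x.2 + 1))
      (fun x => .num ((l x.1).length - (x.2 + 1) + 1)) :=
    Feasible.add (a := fun x : Σ i, Fin (l i).length => (l x.1).length - (x.2 + 1)) hctx.snd
      (hctx.natConst 1)
  have hinit : Feasible par inp fun i => st i (l i).length := by
    simpa [st] using hl.pair (hl.natConst 0)
  have := (hinit.comp (loop hb hB (fun i => ?_) (fun i j hj => ?_) ?_)).snd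
  · simpa [st, Val.snd] using this
  · simp [st, Val.fst, Val.ofList]
  · simp only [st, Val.fst]
    rw [List.drop_eq_getElem_cons (by omega)]
    simp [Val.ofList]
  · refine cast (congrArg _ (funext fun x => ?_)) (hctx.fst.snd.pair hnum)
    have hx : (l x.1).length - x.2 = (l x.1).length - (x.2 + 1) + 1 := by
      have := x.2.2
      omega
    simp only [st, Val.fst]
    rw [hx, ofList_snd, List.tail_drop]

end Feasible

/-! ### Integers, sums, and bit strings -/

/-- The encoding of an integer by its positive and its negative part. -/
def encInt (z : ℤ) : Val := .pair (.num z.toNat) (.num (-z).toNat)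

theorem natSize_natAbs_le (z : ℤ) : Nat.size z.natAbs ≤ (encInt z).size := by
  rcases le_total 0 z with hz | hz
  · have : z.natAbs = z.toNat := by omega
    simp only [encInt, Val.size, this]
    omega
  · have : z.natAbs = (-z).toNat := by omega
    simp only [encInt, Val.size, this]
    omega

theorem size_encInt_le (z : ℤ) : (encInt z).size ≤ 2 * Nat.size z.natAbs + 3 := by
  have h1 : Nat.size z.toNat ≤ Nat.size z.natAbs := Nat.size_le_size (by omega)
  have h2 : Nat.size (-z).toNat ≤ Nat.size z.natAbs := Nat.size_le_size (by omega)
  simp only [encInt, Val.size]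
  omega

/-- The size of a sum is linear in the number and the size of the terms. -/
theorem size_encInt_sum_le {k B : ℕ} {F : ℕ → ℤ} (s : Finset ℕ) (hs : s.card ≤ k)
    (hF : ∀ j ∈ s, (encInt (F j)).size ≤ B) : (encInt (∑ j ∈ s, F j)).size ≤ 2 * (k + B) + 3 := by
  refine (size_encInt_le _).trans ?_
  gcongr
  rw [Nat.size_le]
  have h1 : (∑ j ∈ s, F j).natAbs ≤ ∑ j ∈ s, (F j).natAbs := by
    classical
    exact Int.natAbs_sum_le s F
  have h2 : ∑ j ∈ s, (F j).natAbs ≤ s.card • 2 ^ B := Finset.sum_le_card_nsmul _ _ _ fun j hj =>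
    (Nat.size_le.1 ((natSize_natAbs_le _).trans (hF j hj))).le
  have h3 : s.card < 2 ^ k := hs.trans_lt Nat.lt_two_pow_self
  have h4 : 0 < 2 ^ B := by positivity
  rw [pow_add]
  rw [smul_eq_mul] at h2
  nlinarith

theorem ofList_map_range_eq_ofBits {N : ℕ} (x : Fin N → Bool) :
    Val.ofList ((List.range N).map fun j => .num (if h : j < N then x ⟨j, h⟩ else false).toNat) =
      Val.ofBits x := by
  unfold Val.ofBits
  congr 1
  apply List.ext_getElem <;> simp
  intro i h
  simp [h]

theorem getD_ofBits {N : ℕ} (x : Fin N → Bool) (k : ℕ) :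
    (List.ofFn fun i => Val.num (x i).toNat).getD k (.num 0) =
      .num (if h : k < N then x ⟨k, h⟩ else false).toNat := by
  rw [List.getD_eq_getElem?_getD, List.getElem?_ofFn]
  split <;> simp

namespace Feasible

variable {ι κ : Type} {par : ι → ℕ} {inp f g h : ι → Val} {y z : ι → ℤ} {N : ι → ℕ}

theorem intSub {a b : ι → ℕ} (ha : Feasible par inp fun i => .num (a i))
    (hb : Feasible par inp fun i => .num (b i)) :
    Feasible par inp fun i => encInt (a i - b i) := by
  refine cast (congrArg _ (funext fun i => ?_)) ((ha.sub hb).pair (hb.sub ha))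
  simp only [encInt, Val.pair.injEq, Val.num.injEq]
  omega

theorem intCast {a : ι → ℕ} (ha : Feasible par inp fun i => .num (a i)) :
    Feasible par inp fun i => encInt (a i) := by
  simpa using ha.intSub (ha.natConst 0)

theorem toNat (hz : Feasible par inp fun i => encInt (z i)) :
    Feasible par inp fun i => .num (z i).toNat := hz.fst

theorem toNat_neg (hz : Feasible par inp fun i => encInt (z i)) :
    Feasible par inp fun i => .num (-z i).toNat := hz.snd

theorem intAdd (hy : Feasible par inp fun i => encInt (y i))
    (hz : Feasible par inp fun i => encInt (z i)) :
    Feasible par inp fun i => encInt (y i + z i) := by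
  refine cast (congrArg _ (funext fun i => congrArg _ ?_))
    ((hy.toNat.add hz.toNat).intSub (hy.toNat_neg.add hz.toNat_neg))
  push_cast
  omega

theorem intMul (hy : Feasible par inp fun i => encInt (y i))
    (hz : Feasible par inp fun i => encInt (z i)) :
    Feasible par inp fun i => encInt (y i * z i) := by
  refine cast (congrArg _ (funext fun i => congrArg _ ?_))
    (((hy.toNat.mul hz.toNat).add (hy.toNat_neg.mul hz.toNat_neg)).intSub
      ((hy.toNat.mul hz.toNat_neg).add (hy.toNat_neg.mul hz.toNat)))
  have h1 : y i = (y i).toNat - (-y i).toNat := by omega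
  have h2 : z i = (z i).toNat - (-z i).toNat := by omega
  conv_rhs => rw [h1, h2]
  push_cast
  ring

theorem intLe (hy : Feasible par inp fun i => encInt (y i))
    (hz : Feasible par inp fun i => encInt (z i)) :
    Feasible par inp fun i => .num (decide (y i ≤ z i)).toNat :=
  ((hy.toNat.add hz.toNat_neg).le (hz.toNat.add hy.toNat_neg)).of_bool_eq fun i => by
    rw [decide_eq_decide]
    omega

theorem intSign {c : ι → Bool} (hc : Feasible par inp fun i => .num (c i).toNat) :
    Feasible par inp fun i => encInt ((-1) ^ (c i).toNat) := by
  refine cast (congrArg _ (funext fun i => congrArg _ ?_))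
    ((hc.natConst 1).intSub ((hc.natConst 2).mul hc))
  cases c i <;> rfl

theorem intIte {c : ι → Bool} (hc : Feasible par inp fun i => .num (c i).toNat)
    (hy : Feasible par inp fun i => encInt (y i)) (hz : Feasible par inp fun i => encInt (z i)) :
    Feasible par inp fun i => encInt (if c i then y i else z i) := by
  refine cast (congrArg _ (funext fun i => ?_)) (hc.ite hy hz)
  split <;> rfl

theorem sum_range {k : ι → ℕ} {F : ι → ℕ → ℤ}
    (hk : Feasible par inp fun i => .num (k i)) (hK : PolyBounded par k)
    (hF : ∀ ctx : (Σ i, Fin (k i)) → Val, Extends par inp Sigma.fst ctx →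
      Feasible (fun x => par x.1) ctx (fun x => .num x.2) →
      Feasible (fun x => par x.1) ctx (fun x => encInt (F x.1 x.2))) :
    Feasible par inp fun i => encInt (∑ j ∈ Finset.range (k i), F i j) := by
  obtain ⟨ctx, h1, h2⟩ := exists_extends hk hK
  obtain ⟨B, hB⟩ := (hF ctx h1 h2).bounded
  obtain ⟨K, hK'⟩ := hK
  have := countdown (st := fun i c => encInt (∑ j ∈ Finset.Ico c (k i), F i j)) hk ⟨K, hK'⟩
    ⟨2 * (K + B) + 3, fun i c hc => ?_⟩ (by simpa using (hk.natConst 0).intCast) ?_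
  · simp only [Finset.range_eq_Ico]
    exact this
  · simp only [Polynomial.eval_add, Polynomial.eval_mul, Polynomial.eval_ofNat]
    refine size_encInt_sum_le _ ?_ fun j hj => ?_
    · have := hK' i
      simp only [Nat.card_Ico]
      omega
    · exact hB ⟨i, j, (Finset.mem_Ico.1 hj).2⟩
  · intro ctx he hj hst
    refine cast (congrArg _ (funext fun x => congrArg _ ?_)) ((hF ctx he hj).intAdd hst)
    exact (Finset.sum_eq_sum_Ico_succ_bot x.2.isLt (F x.1)).symm

theorem sum_fin {k : ι → ℕ} {F : ∀ i, Fin (k i) → ℕ}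
    (hk : Feasible par inp fun i => .num (k i)) (hK : PolyBounded par k)
    (hF : ∀ ctx : (Σ i, Fin (k i)) → Val, Extends par inp Sigma.fst ctx →
      Feasible (fun x => par x.1) ctx (fun x => .num x.2) →
      Feasible (fun x => par x.1) ctx (fun x => .num (F x.1 x.2))) :
    Feasible par inp fun i => .num (∑ j, F i j) := by
  refine cast (congrArg _ (funext fun i => ?_)) (sum_range
    (F := fun i j => if h : j < k i then F i ⟨j, h⟩ else 0) hk hK fun ctx he hj => ?_).toNat
  · rw [Finset.sum_range]
    simp only [Fin.is_lt, dite_true, Fin.eta]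
    rw [← Nat.cast_sum, Int.toNat_natCast]
  · simpa using (hF ctx he hj).intCast

/-- A bit string is feasible if its length and its single bits are. -/
theorem ofBits {x : ∀ i, Fin (N i) → Bool} (hN : Feasible par inp fun i => .num (N i))
    (hb : PolyBounded par N)
    (hx : ∀ ctx : (Σ i, Fin (N i)) → Val, Extends par inp Sigma.fst ctx →
      Feasible (fun x => par x.1) ctx (fun x => .num x.2) →
      Feasible (fun x => par x.1) ctx (fun k => .num (x k.1 k.2).toNat)) :
    Feasible par inp fun i => .ofBits (x i) := by
  simp only [← ofList_map_range_eq_ofBits]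
  exact map_range hN hb fun ctx he hj => by simpa using hx ctx he hj

theorem bounded_length {x : ∀ i, Fin (N i) → Bool}
    (hx : Feasible par inp fun i => .ofBits (x i)) : PolyBounded par N :=
  hx.bounded.mono fun i => by
    have := length_lt_size_ofList (List.ofFn fun j => Val.num (x i j).toNat)
    rw [List.length_ofFn] at this
    exact this.le

theorem bitLength {x : ∀ i, Fin (N i) → Bool} (hx : Feasible par inp fun i => .ofBits (x i)) :
    Feasible par inp fun i => .num (N i) := by
  simpa using length (l := fun i => List.ofFn fun j => .num (x i j).toNat) hx

/-- Access to a bit, with the default value `false` beyond the end of the string. -/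
theorem getBitD {x : ∀ i, Fin (N i) → Bool} {k : ι → ℕ}
    (hx : Feasible par inp fun i => .ofBits (x i)) (hk : Feasible par inp fun i => .num (k i))
    (hb : PolyBounded par k) : Feasible par inp fun i =>
      .num (if h : k i < N i then x i ⟨k i, h⟩ else false).toNat := by
  simpa only [getD_ofBits] using
    getList (l := fun i => List.ofFn fun j => .num (x i j).toNat) hx hk hb

theorem getBit {x : ∀ i, Fin (N i) → Bool} {k : ∀ i, Fin (N i)}
    (hx : Feasible par inp fun i => .ofBits (x i)) (hk : Feasible par inp fun i => .num (k i)) :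
    Feasible par inp fun i => .num (x i (k i)).toNat := by
  simpa using hx.getBitD hk (hx.bounded_length.mono fun i => (k i).2.le)

/-- A bit string is feasible if every bit is computed from the corresponding bit of another one. -/
theorem mapBits {x : ∀ i, Fin (N i) → Bool} {y : ∀ i, Fin (N i) → Bool}
    (hx : Feasible par inp fun i => .ofBits (x i))
    (hy : ∀ ctx : (Σ i, Fin (N i)) → Val, Extends par inp Sigma.fst ctx →
      Feasible (fun x => par x.1) ctx (fun x => .num x.2) →
      Feasible (fun x => par x.1) ctx (fun k => .num (x k.1 k.2).toNat) →
      Feasible (fun x => par x.1) ctx (fun k => .num (y k.1 k.2).toNat)) :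
    Feasible par inp fun i => .ofBits (y i) :=
  ofBits hx.bitLength hx.bounded_length fun ctx he hj =>
    hy ctx he hj (getBit (N := fun k : Σ i, Fin (N i) => N k.1) (x := fun k => x k.1)
      (k := fun k => k.2) (he hx) hj)

end Feasible

/-! ### Lists of bit strings -/

/-- The encoding of a list of bit strings. -/
def encList {N : ℕ} (l : List (Fin N → Bool)) : Val := .ofList (l.map Val.ofBits)

theorem size_ofBits_le {N : ℕ} (x : Fin N → Bool) : (Val.ofBits x).size ≤ 3 * N + 1 := by
  rw [Val.ofBits, size_ofList]
  gcongr
  refine (List.sum_le_card_nsmul _ 3 fun m hm => ?_).trans (by simp [mul_comm])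
  simp only [List.map_ofFn, List.mem_ofFn, Function.comp] at hm
  obtain ⟨i, rfl⟩ := hm
  cases x i <;> simp [Val.size]

theorem size_encList_le {N : ℕ} (l : List (Fin N → Bool)) :
    (encList l).size ≤ l.length * (3 * N + 2) + 1 := by
  rw [encList, size_ofList]
  gcongr
  refine (List.sum_le_card_nsmul _ (3 * N + 2) fun m hm => ?_).trans (by simp)
  simp only [List.map_map, List.mem_map, Function.comp] at hm
  obtain ⟨x, _, rfl⟩ := hm
  exact Nat.add_le_add_right (size_ofBits_le x) 1

theorem map_range_length {α β : Type} (l : List α) (F : ℕ → β) (G : α → β)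
    (h : ∀ j (hj : j < l.length), F j = G l[j]) : (List.range l.length).map F = l.map G := by
  apply List.ext_getElem <;> simp
  exact h

theorem map_filter_range_length {α β : Type} (l : List α) (c : ℕ → Bool) (p : α → Bool)
    (F : ℕ → β) (G : α → β) (hc : ∀ j (hj : j < l.length), c j = p l[j])
    (h : ∀ j (hj : j < l.length), F j = G l[j]) :
    ((List.range l.length).filter c).map F = (l.filter p).map G := by
  conv_rhs => rw [← List.map_get_finRange l]
  rw [← List.map_coe_finRange_eq_range, List.filter_map, List.filter_map, List.map_map,
    List.map_map]
  have : c ∘ (fun j : Fin l.length => (j : ℕ)) = p ∘ l.get := funext fun j => hc j j.2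
  rw [this]
  exact List.map_congr_left fun j _ => h j j.2

namespace Extends

variable {ι κ κ' : Type} {par : ι → ℕ} {inp : ι → Val} {e : κ → ι} {ctx : κ → Val}

theorem trans (h : Extends par inp e ctx) {e' : κ' → κ} {ctx' : κ' → Val}
    (h' : Extends (fun k => par (e k)) ctx e' ctx') :
    Extends par inp (fun k => e (e' k)) ctx' := fun _ hf => h' (h hf)

end Extends

namespace Feasible

variable {ι : Type} {par : ι → ℕ} {inp : ι → Val} {N : ι → ℕ}
  {l : ∀ i, List (Fin (N i) → Bool)}

theorem lengthBits (hl : Feasible par inp fun i => encList (l i)) :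
    Feasible par inp fun i => .num (l i).length := by
  simpa using length (l := fun i => (l i).map Val.ofBits) hl

theorem bounded_lengthBits (hl : Feasible par inp fun i => encList (l i)) :
    PolyBounded par fun i => (l i).length :=
  hl.bounded.mono fun i => by
    have := length_lt_size_ofList ((l i).map Val.ofBits)
    rw [List.length_map] at this
    exact this.le

theorem getBits {k : ∀ i, Fin (l i).length} (hl : Feasible par inp fun i => encList (l i))
    (hk : Feasible par inp fun i => .num (k i)) :
    Feasible par inp fun i => .ofBits ((l i)[k i]) := by
  refine cast (congrArg _ (funext fun i => ?_)) (getList (l := fun i => (l i).map Val.ofBits) hl hk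
    (hl.bounded_lengthBits.mono fun i => (k i).2.le))
  simp

theorem filterBits {p : ∀ i, (Fin (N i) → Bool) → Bool}
    (hl : Feasible par inp fun i => encList (l i))
    (hp : ∀ ctx : (Σ i, Fin (l i).length) → Val, Extends par inp Sigma.fst ctx →
      Feasible (fun x => par x.1) ctx (fun x => .ofBits (l x.1)[x.2]) →
      Feasible (fun x => par x.1) ctx (fun x => .num (p x.1 (l x.1)[x.2]).toNat)) :
    Feasible par inp fun i => encList ((l i).filter (p i)) := by
  refine cast (congrArg _ (funext fun i => congrArg Val.ofList ?_)) (comprehension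
    (c := fun i j => if h : j < (l i).length then p i (l i)[j] else false)
    (F := fun i j => if h : j < (l i).length then .ofBits (l i)[j] else .num 0)
    hl.lengthBits hl.bounded_lengthBits (fun ctx he hj => ?_) fun ctx he hj => ?_)
  · exact map_filter_range_length _ _ _ _ _ (fun j hj => by simp [hj]) fun j hj => by simp [hj]
  · simpa using hp ctx he
      (getBits (N := fun x : Σ i, Fin (l i).length => N x.1) (l := fun x => l x.1)
        (k := fun x => x.2) (he hl) hj)
  · simpa using getBits (N := fun x : Σ i, Fin (l i).length => N x.1) (l := fun x => l x.1)
        (k := fun x => x.2) (he hl) hj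

theorem mapBitsList {g : ∀ i, (Fin (N i) → Bool) → (Fin (N i) → Bool)}
    (hl : Feasible par inp fun i => encList (l i))
    (hg : ∀ ctx : (Σ i, Fin (l i).length) → Val, Extends par inp Sigma.fst ctx →
      Feasible (fun x => par x.1) ctx (fun x => .ofBits (l x.1)[x.2]) →
      Feasible (fun x => par x.1) ctx (fun x => .ofBits (g x.1 (l x.1)[x.2]))) :
    Feasible par inp fun i => encList ((l i).map (g i)) := by
  refine cast (congrArg _ (funext fun i => congrArg Val.ofList ?_)) (map_range
    (F := fun i j => if h : j < (l i).length then .ofBits (g i (l i)[j]) else .num 0)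
    hl.lengthBits hl.bounded_lengthBits fun ctx he hj => ?_)
  · rw [List.map_map]
    exact map_range_length _ _ _ fun j hj => by simp [hj]
  · simpa using hg ctx he
      (getBits (N := fun x : Σ i, Fin (l i).length => N x.1) (l := fun x => l x.1)
        (k := fun x => x.2) (he hl) hj)

theorem sumList {F : ∀ i, (Fin (N i) → Bool) → ℤ}
    (hl : Feasible par inp fun i => encList (l i))
    (hF : ∀ ctx : (Σ i, Fin (l i).length) → Val, Extends par inp Sigma.fst ctx →
      Feasible (fun x => par x.1) ctx (fun x => .ofBits (l x.1)[x.2]) →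
      Feasible (fun x => par x.1) ctx (fun x => encInt (F x.1 (l x.1)[x.2]))) :
    Feasible par inp fun i => encInt ((l i).map (F i)).sum := by
  refine cast (congrArg _ (funext fun i => congrArg _ ?_)) (sum_range
    (F := fun i j => if h : j < (l i).length then F i (l i)[j] else 0)
    hl.lengthBits hl.bounded_lengthBits fun ctx he hj => ?_)
  · rw [Finset.sum_range, ← Fin.sum_univ_fun_getElem]
    simp
  · simpa using hF ctx he
      (getBits (N := fun x : Σ i, Fin (l i).length => N x.1) (l := fun x => l x.1)
        (k := fun x => x.2) (he hl) hj)

theorem appendBits {l' : ∀ i, List (Fin (N i) → Bool)}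
    (hl : Feasible par inp fun i => encList (l i))
    (hl' : Feasible par inp fun i => encList (l' i)) :
    Feasible par inp fun i => encList (l i ++ l' i) := by
  refine cast (congrArg _ (funext fun i => congrArg Val.ofList ?_)) (map_range
    (F := fun i j => if decide (j < (l i).length) then ((l i).map Val.ofBits).getD j (.num 0)
      else ((l' i).map Val.ofBits).getD (j - (l i).length) (.num 0))
    (hl.lengthBits.add hl'.lengthBits) (hl.bounded_lengthBits.add hl'.bounded_lengthBits)
    fun ctx he hj => ?_)
  · apply List.ext_getElem
    · simp
    · intro j h1 h2
      simp only [List.length_map, List.length_range] at h1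
      simp only [List.getElem_map, List.getElem_range, List.getElem_append]
      split
      · next h =>
        have h := of_decide_eq_true h
        simp [h]
      · next h =>
        have h : ¬ j < (l i).length := fun h' => h (decide_eq_true h')
        have h' : j - (l i).length < (l' i).length := by omega
        simp [h, h']
  · have hb : PolyBounded (fun x : Σ i, Fin ((l i).length + (l' i).length) => par x.1)
        fun x => x.2 :=
      ((hl.bounded_lengthBits.add hl'.bounded_lengthBits).comp Sigma.fst).mono fun x => x.2.2.le
    exact (hj.lt (he hl.lengthBits)).ite
      (getList (l := fun x : Σ i, Fin ((l i).length + (l' i).length) => (l x.1).map Val.ofBits)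
        (he hl) hj hb)
      (getList (l := fun x : Σ i, Fin ((l i).length + (l' i).length) => (l' x.1).map Val.ofBits)
        (he hl') (hj.sub (he hl.lengthBits)) (hb.mono fun x => Nat.sub_le _ _))

end Feasible

/-! ### The Kushilevitz–Mansour search -/

/-- Sets the bit number `c`. -/
def setBit {N : ℕ} (c : ℕ) (v : Fin N → Bool) : Fin N → Bool := fun i => decide (c = i) || v i

/-- The candidates after `d` rounds of the search: bit strings in which only the last `d` bits may
be nonzero. In every round both values of one more bit are tried and only the bit strings that pass
the test `pass` are kept. Too long lists are discarded, in order to bound the running time. -/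
def candidates {N : ℕ} (pass : ℕ → (Fin N → Bool) → Bool) (cap : ℕ) : ℕ → List (Fin N → Bool)
  | 0 => [fun _ => false]
  | d + 1 =>
    let l := (candidates pass cap d ++ (candidates pass cap d).map (setBit (N - (d + 1)))).filter
      (pass (N - (d + 1)))
    if l.length ≤ cap then l else []

theorem length_candidates_le {N : ℕ} (pass : ℕ → (Fin N → Bool) → Bool) (cap d : ℕ) :
    (candidates pass cap d).length ≤ cap + 1 := by
  cases d with
  | zero => simp [candidates]
  | succ d =>
    simp only [candidates]
    split
    · omega
    · simp

namespace Feasible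

variable {ι : Type} {par : ι → ℕ} {inp : ι → Val} {N : ι → ℕ}

theorem setBit {c : ι → ℕ} {v : ∀ i, Fin (N i) → Bool}
    (hc : Feasible par inp fun i => .num (c i)) (hv : Feasible par inp fun i => .ofBits (v i)) :
    Feasible par inp fun i => .ofBits (setBit (c i) (v i)) :=
  hv.mapBits fun ctx he hj hvj => (((hj.lt (he hc)).not.and ((he hc).lt hj).not).not.and
    hvj.not).not.of_bool_eq fun k => by
      simp only [QSim.setBit]
      rcases lt_trichotomy (c k.1) k.2 with h | h | h
      · simp [h, h.ne, h.not_gt]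
      · simp [h]
      · simp [h, h.ne', h.not_gt]

/-- The search runs in polynomial time if the test does, whatever the outcomes of the test are. -/
theorem candidates {pass : ∀ i, ℕ → (Fin (N i) → Bool) → Bool} {cap : ι → ℕ}
    (hN : Feasible par inp fun i => .num (N i)) (hb : PolyBounded par N)
    (hcap : Feasible par inp fun i => .num (cap i)) (hcb : PolyBounded par cap)
    -- the test is needed in the body of a nested loop, hence for all the extensions of the input
    (hp : ∀ {κ : Type} {e : κ → ι} {ctx : κ → Val} {c : κ → ℕ} {v : ∀ k, Fin (N (e k)) → Bool},
      Extends par inp e ctx → Feasible (fun k => par (e k)) ctx (fun k => .num (c k)) →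
      Feasible (fun k => par (e k)) ctx (fun k => .ofBits (v k)) →
      Feasible (fun k => par (e k)) ctx (fun k => .num (pass (e k) (c k) (v k)).toNat)) :
    Feasible par inp fun i => encList (candidates (pass i) (cap i) (N i)) := by
  have := countdown (st := fun i c => encList (QSim.candidates (pass i) (cap i) (N i - c))) hN hb
    ?_ ?_ ?_
  · simpa using this
  · obtain ⟨B, hB⟩ := ((hcb.add (.const _ 1)).mul (((PolyBounded.const par 3).mul hb).add
      (.const _ 2))).add (.const _ 1)
    exact ⟨B, fun i c _ => (size_encList_le _).trans (le_trans (Nat.add_le_add_right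
      (Nat.mul_le_mul_right _ (length_candidates_le _ _ _)) 1) (hB i))⟩
  · simp only [Nat.sub_self, QSim.candidates, encList, List.map_cons, List.map_nil, Val.ofList]
    exact (ofBits (x := fun _ _ => false) hN hb fun ctx he hj => hj.natConst 0).pair (hN.natConst 0)
  · intro ctx he hj hst
    have h1 := appendBits hst (hst.mapBitsList (g := fun x => QSim.setBit x.2)
      fun ctx' he' hv => (he' hj).setBit hv)
    have h2 := h1.filterBits (p := fun x => pass x.1 x.2) fun ctx' he' hv =>
      hp (he.trans he') (he' hj) hv
    refine cast (congrArg _ (funext fun x => ?_))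
      ((h2.lengthBits.le (he hcap)).ite h2 (hj.natConst 0))
    have hx : N x.1 - x.2 = N x.1 - (x.2 + 1) + 1 := by
      have := x.2.2
      omega
    have hx' : N x.1 - (N x.1 - (x.2 + 1) + 1) = x.2 := by
      have := x.2.2
      omega
    rw [hx, QSim.candidates, hx']
    simp only [decide_eq_true_eq, apply_ite encList]
    rfl

end Feasible

/-! ### The estimates computed from a sample -/

/-- Bitwise addition modulo two. -/
def bitXor {N : ℕ} (v x : Fin N → Bool) : Fin N → Bool := fun i => v i ^^ x i

/-- The restriction of a bit string to the bits from number `c` on, with zeros elsewhere. -/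
def highBits {N : ℕ} (c : ℕ) (w : Fin N → Bool) : Fin N → Bool := fun i => decide (c ≤ i) && w i

/-- The restriction of a bit string to the bits in `A`, with zeros elsewhere. -/
def maskBits {N : ℕ} (A : Finset (Fin N)) (w : Fin N → Bool) : Fin N → Bool :=
  fun i => decide (i ∈ A) && w i

/-- The character `(-1) ^ (v ⬝ x)`. -/
def character {N : ℕ} (v x : Fin N → Bool) : ℤ := (-1) ^ ∑ i, (v i && x i).toNat

/-- Row number `r` of a table with rows of length `B` that is stored line by line in `ω`; only the
first `N` entries of the row are used. -/
def tableRow {ℓ : ℕ} (ω : Fin ℓ → Bool) (B N r : ℕ) : Fin N → Bool :=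
  fun i => if h : r * B + i < ℓ then ω ⟨r * B + i, h⟩ else false

namespace FiveRound

variable {N : ℕ} (C : FiveRound N)

/-- The sign `(-1) ^ g` of the output on the bits in `S` of a string of `N` bits. -/
def outSign (x : Fin N → Bool) : ℤ := (-1) ^ (C.g fun i => x i).toNat

/-- A random variable whose expectation value, for uniformly random `z` and `w`, is the sum of the
squares of the Fourier coefficients of `outSign` over all the `v` that agree with `α` on the bits
from number `c` on. -/
def weightTerm (c : ℕ) (α z w : Fin N → Bool) : ℤ :=
  C.outSign z * C.outSign (bitXor z (highBits c w)) * character α (highBits c w)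

/-- A random variable whose expectation value, for uniformly random `z`, is the Fourier coefficient
of `outSign` at `v`. -/
def coeffTerm (v z : Fin N → Bool) : ℤ := C.outSign z * character v z

/-- A random variable whose expectation value, for uniformly random `z`, is the expectation value
of the Pauli operator `X ^ v` in the state after the second round, if `R` and `I` are the real and
the imaginary part of `γ`. The random string is masked with `A`, because the state after the first
round is the uniform superposition of the strings that vanish outside `A`. -/
def overlapTerm {K : Type} [Ring K] (R I : (Fin N → Bool) → K) (v z : Fin N → Bool) : K :=
  let x := maskBits C.A z
  let x' := C.π.symm (bitXor (C.π x) v)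
  if maskBits C.A x' = x' then R x * R x' + I x * I x' else 0

/-- The test of the search for large Fourier coefficients: it compares the empirical weight in the
sample `ω` with `1 / (2 * D ^ 2)`. -/
def heavyTest (M B D : ℕ) {ℓ : ℕ} (ω : Fin ℓ → Bool) (c : ℕ) (α : Fin N → Bool) : Bool :=
  decide ((M : ℤ) ≤ 2 * D ^ 2 *
    ∑ j ∈ Finset.range M, C.weightTerm c α (tableRow ω B N (2 * j)) (tableRow ω B N (2 * j + 1)))

/-- The numerator of the estimate for the expectation value; the denominator is `(M * Q) ^ 2`. -/
def estimate (M B D cap : ℕ) (R I : (Fin N → Bool) → ℤ) {ℓ : ℕ} (ω : Fin ℓ → Bool) : ℤ :=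
  ((candidates (C.heavyTest M B D ω) cap N).map fun v =>
    (∑ j ∈ Finset.range M, C.coeffTerm v (tableRow ω B N (2 * j))) *
      ∑ j ∈ Finset.range M, C.overlapTerm R I v (tableRow ω B N (2 * j))).sum

end FiveRound

namespace Feasible

variable {κ : Type} {n : κ → ℕ} {ctx : κ → Val} {N : κ → ℕ}

theorem bitXor {v x : ∀ k, Fin (N k) → Bool} (hv : Feasible n ctx fun k => .ofBits (v k))
    (hx : Feasible n ctx fun k => .ofBits (x k)) :
    Feasible n ctx fun k => .ofBits (bitXor (v k) (x k)) :=
  hv.mapBits fun _ he hj hvj => hvj.xor (getBit (N := fun k : Σ i, Fin (N i) => N k.1)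
    (x := fun k => x k.1) (k := fun k => k.2) (he hx) hj)

theorem highBits {c : κ → ℕ} {w : ∀ k, Fin (N k) → Bool}
    (hc : Feasible n ctx fun k => .num (c k)) (hw : Feasible n ctx fun k => .ofBits (w k)) :
    Feasible n ctx fun k => .ofBits (highBits (c k) (w k)) :=
  hw.mapBits fun _ he hj hwj => ((he hc).le hj).and hwj

theorem maskBits {A : ∀ k, Finset (Fin (N k))} {w : ∀ k, Fin (N k) → Bool}
    (hA : Feasible n ctx fun k => .ofBits fun i => decide (i ∈ A k))
    (hw : Feasible n ctx fun k => .ofBits (w k)) :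
    Feasible n ctx fun k => .ofBits (maskBits (A k) (w k)) :=
  hw.mapBits fun _ he hj hwj => (getBit (N := fun k : Σ i, Fin (N i) => N k.1)
    (x := fun k i => decide (i ∈ A k.1)) (k := fun k => k.2) (he hA) hj).and hwj

theorem character {v x : ∀ k, Fin (N k) → Bool} (hv : Feasible n ctx fun k => .ofBits (v k))
    (hx : Feasible n ctx fun k => .ofBits (x k)) :
    Feasible n ctx fun k => encInt (character (v k) (x k)) := by
  have ht : Feasible n ctx fun k => .num (∑ i, (v k i && x k i).toNat) :=
    sum_fin hv.bitLength hv.bounded_length fun ctx' he hj =>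
      (getBit (N := fun k : Σ i, Fin (N i) => N k.1) (x := fun k => v k.1)
        (k := fun k => k.2) (he hv) hj).and
      (getBit (N := fun k : Σ i, Fin (N i) => N k.1) (x := fun k => x k.1)
        (k := fun k => k.2) (he hx) hj)
  -- the sign is computed from the parity `t - 2 * (t / 2)` of the exponent `t`
  have hp := ht.sub ((ht.natConst 2).mul (ht.div (ht.natConst 2)))
  refine cast (congrArg _ (funext fun k => congrArg _ ?_))
    ((ht.natConst 1).intSub ((ht.natConst 2).mul hp))
  unfold QSim.character
  generalize ∑ i, (v k i && x k i).toNat = t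
  obtain ⟨s, rfl | rfl⟩ := Nat.even_or_odd' t
  · simp [pow_mul]
  · rw [pow_succ, pow_mul]
    have : 2 * s + 1 - 2 * ((2 * s + 1) / 2) = 1 := by omega
    rw [this]
    simp

theorem tableRow {ℓ B r : κ → ℕ} {ω : ∀ k, Fin (ℓ k) → Bool}
    (hω : Feasible n ctx fun k => .ofBits (ω k))
    (hB : Feasible n ctx fun k => .num (B k)) (hBb : PolyBounded n B)
    (hN : Feasible n ctx fun k => .num (N k)) (hNb : PolyBounded n N)
    (hr : Feasible n ctx fun k => .num (r k)) (hrb : PolyBounded n r) :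
    Feasible n ctx fun k => .ofBits (tableRow (ω k) (B k) (N k) (r k)) :=
  ofBits hN hNb fun _ he hj => getBitD (N := fun k : Σ i, Fin (N i) => ℓ k.1)
    (x := fun k => ω k.1) (k := fun k => r k.1 * B k.1 + k.2) (he hω)
    (((he hr).mul (he hB)).add hj)
    ((((hrb.mul hBb).add hNb).comp Sigma.fst).mono fun k => Nat.add_le_add_left k.2.2.le _)

/-- Equality of bit strings is decided by counting the positions at which they differ. -/
theorem bitsEq {x y : ∀ k, Fin (N k) → Bool} (hx : Feasible n ctx fun k => .ofBits (x k))
    (hy : Feasible n ctx fun k => .ofBits (y k)) :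
    Feasible n ctx fun k => .num (decide (x k = y k)).toNat := by
  have ht : Feasible n ctx fun k => .num (∑ i, (x k i ^^ y k i).toNat) :=
    sum_fin hx.bitLength hx.bounded_length fun ctx' he hj =>
      (getBit (N := fun k : Σ i, Fin (N i) => N k.1) (x := fun k => x k.1)
        (k := fun k => k.2) (he hx) hj).xor
      (getBit (N := fun k : Σ i, Fin (N i) => N k.1) (x := fun k => y k.1)
        (k := fun k => k.2) (he hy) hj)
  refine (ht.lt (ht.natConst 1)).of_bool_eq fun k => ?_
  rw [decide_eq_decide, Nat.lt_one_iff, Finset.sum_eq_zero_iff, funext_iff]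
  refine forall_congr' fun i => ?_
  cases x k i <;> cases y k i <;> simp

end Feasible

/-- Rounding a rational approximation to a multiple of `1 / Q`. -/
theorem abs_sub_fixedPoint_le {a b d Q : ℕ} {p : ℚ} {r : ℝ} (hd : 0 < d) (hQ : 0 < Q)
    (hp : p = ((a : ℚ) - b) / d) (hr : |r - p| ≤ (1 / 2 : ℝ) ^ Q) :
    |r - (((a * Q / d : ℕ) - (b * Q / d : ℕ) : ℤ) : ℝ) / Q| ≤ 2 / Q := by
  have hd' : (0 : ℝ) < d := by exact_mod_cast hd
  have hQ' : (0 : ℝ) < Q := by exact_mod_cast hQ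
  have hpow : (1 / 2 : ℝ) ^ Q ≤ 1 / Q := by
    rw [div_pow, one_pow]
    apply one_div_le_one_div_of_le hQ'
    exact_mod_cast Nat.lt_two_pow_self.le
  have hfloor : ∀ m : ℕ, ((m * Q / d : ℕ) : ℝ) ≤ m * Q / d ∧
      (m : ℝ) * Q / d < (m * Q / d : ℕ) + 1 := by
    intro m
    constructor
    · exact_mod_cast (Nat.cast_div_le (m := m * Q) (n := d) (α := ℝ))
    · rw [div_lt_iff₀ hd']
      exact_mod_cast Nat.lt_mul_of_div_lt (Nat.lt_succ_self (m * Q / d)) hd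
  obtain ⟨ha1, ha2⟩ := hfloor a
  obtain ⟨hb1, hb2⟩ := hfloor b
  have hp' : (p : ℝ) * Q = a * Q / d - b * Q / d := by
    rw [hp]
    push_cast
    ring
  have key : |(p : ℝ) - (((a * Q / d : ℕ) - (b * Q / d : ℕ) : ℤ) : ℝ) / Q| ≤ 1 / Q := by
    rw [sub_div' hQ'.ne', abs_div, abs_of_pos hQ', hp']
    gcongr
    rw [Int.cast_sub, Int.cast_natCast, Int.cast_natCast, abs_le]
    constructor <;> linarith
  calc _ ≤ |r - p| + |(p : ℝ) - (((a * Q / d : ℕ) - (b * Q / d : ℕ) : ℤ) : ℝ) / Q| :=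
        abs_sub_le _ _ _
    _ ≤ 1 / Q + 1 / Q := add_le_add (hr.trans hpow) key
    _ = 2 / Q := by ring

namespace Efficient

variable {N : ℕ → ℕ} {C : ∀ n, FiveRound (N n)} {κ : Type} {n : κ → ℕ} {ctx : κ → Val}

theorem feasible_first (hC : Efficient C) (hn : Feasible n ctx fun k => .num (n k)) :
    Feasible n ctx fun k => .ofBits fun i => decide (i ∈ (C (n k)).A) :=
  hn.comp (Feasible.reindex (par := fun n => n) hC.first n)

theorem feasible_second (hC : Efficient C) (hn : Feasible n ctx fun k => .num (n k)) :
    Feasible n ctx fun k => .ofBits fun i => decide (i ∈ (C (n k)).S) :=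
  hn.comp (Feasible.reindex (par := fun n => n) hC.second n)

/-- The number of qubits is polynomially bounded, because the program that computes `A` writes one
bit for every qubit. -/
theorem bounded_qubits (hC : Efficient C) : PolyBounded (fun n => n) N :=
  Feasible.bounded_length (x := fun n i => decide (i ∈ (C n).A)) hC.first

variable {x : ∀ k, Fin (N (n k)) → Bool}

theorem feasible_perm (hC : Efficient C) (hn : Feasible n ctx fun k => .num (n k))
    (hx : Feasible n ctx fun k => .ofBits (x k)) :
    Feasible n ctx fun k => .ofBits ((C (n k)).π (x k)) :=
  (hn.pair hx).comp (Feasible.reindex (κ := κ) hC.perm fun k => ⟨n k, x k⟩)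

theorem feasible_perm_symm (hC : Efficient C) (hn : Feasible n ctx fun k => .num (n k))
    (hx : Feasible n ctx fun k => .ofBits (x k)) :
    Feasible n ctx fun k => .ofBits ((C (n k)).π.symm (x k)) :=
  (hn.pair hx).comp (Feasible.reindex (κ := κ) hC.perm_symm fun k => ⟨n k, x k⟩)

theorem feasible_outSign (hC : Efficient C) (hn : Feasible n ctx fun k => .num (n k))
    (hx : Feasible n ctx fun k => .ofBits (x k)) :
    Feasible n ctx fun k => encInt ((C (n k)).outSign (x k)) := by
  refine Feasible.intSign ((hn.pair ?_).comp
    (Feasible.reindex (κ := κ) hC.post fun k => ⟨n k, fun i => x k i⟩))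
  refine cast (congrArg _ (funext fun k => congrArg Val.ofBits (funext fun i => ?_)))
    ((hC.feasible_second hn).maskBits hx)
  by_cases hi : i ∈ (C (n k)).S <;> simp [maskBits, FiveRound.extend, hi]

/-- Fixed-point approximations of the coefficients `γ x` with the denominator `Q` are feasible. -/
theorem exists_phase (hC : Efficient C) : ∃ R I : ∀ n, ℕ → (Fin (N n) → Bool) → ℤ,
    (∀ n Q x, 0 < Q → |((C n).γ x).re - (R n Q x : ℝ) / Q| ≤ 2 / Q ∧
      |((C n).γ x).im - (I n Q x : ℝ) / Q| ≤ 2 / Q) ∧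
    ∀ {κ : Type} {n : κ → ℕ} {ctx : κ → Val} {Q : κ → ℕ} {x : ∀ k, Fin (N (n k)) → Bool},
      Feasible n ctx (fun k => .num (n k)) → Feasible n ctx (fun k => .num (Q k)) →
      PolyBounded n Q → Feasible n ctx (fun k => .ofBits (x k)) →
      Feasible n ctx (fun k => encInt (R (n k) (Q k) (x k))) ∧
      Feasible n ctx (fun k => encInt (I (n k) (Q k) (x k))) := by
  obtain ⟨out, hout, hgood⟩ := hC.phase.exists_feasible
  choose va vb p q hv ha hb hp hq using hgood
  choose a₁ b₁ d₁ hd₁ ha hp' using ha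
  choose a₂ b₂ d₂ hd₂ hb hq' using hb
  refine ⟨fun n Q x => ((a₁ ⟨Q, n, x⟩ * Q / d₁ ⟨Q, n, x⟩ : ℕ) : ℤ) -
      (b₁ ⟨Q, n, x⟩ * Q / d₁ ⟨Q, n, x⟩ : ℕ),
    fun n Q x => ((a₂ ⟨Q, n, x⟩ * Q / d₂ ⟨Q, n, x⟩ : ℕ) : ℤ) -
      (b₂ ⟨Q, n, x⟩ * Q / d₂ ⟨Q, n, x⟩ : ℕ), fun n Q x hQ => ⟨?_, ?_⟩, ?_⟩
  · exact abs_sub_fixedPoint_le (hd₁ _) hQ (hp' _) (hp ⟨Q, n, x⟩)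
  · exact abs_sub_fixedPoint_le (hd₂ _) hQ (hq' _) (hq ⟨Q, n, x⟩)
  · intro κ n ctx Q x hn hQ hQb hx
    have h := ((hn.pair (hQ.pair hx)).comp ((Feasible.reindex (κ := κ) hout
      fun k => ⟨Q k, n k, x k⟩).change_par ((PolyBounded.self n).add hQb)))
    have h₁ := h.fst
    have h₂ := h.snd
    simp only [hv, ha, hb, Val.fst, Val.snd] at h₁ h₂
    exact ⟨((h₁.fst.fst.mul hQ).div h₁.snd).intSub ((h₁.fst.snd.mul hQ).div h₁.snd),
      ((h₂.fst.fst.mul hQ).div h₂.snd).intSub ((h₂.fst.snd.mul hQ).div h₂.snd)⟩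

theorem feasible_weightTerm (hC : Efficient C) {c : κ → ℕ} {α z w : ∀ k, Fin (N (n k)) → Bool}
    (hn : Feasible n ctx fun k => .num (n k)) (hc : Feasible n ctx fun k => .num (c k))
    (hα : Feasible n ctx fun k => .ofBits (α k)) (hz : Feasible n ctx fun k => .ofBits (z k))
    (hw : Feasible n ctx fun k => .ofBits (w k)) :
    Feasible n ctx fun k => encInt ((C (n k)).weightTerm (c k) (α k) (z k) (w k)) :=
  ((hC.feasible_outSign hn hz).intMul
    (hC.feasible_outSign hn (hz.bitXor (hc.highBits hw)))).intMul (hα.character (hc.highBits hw))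

theorem feasible_overlapTerm (hC : Efficient C) {v z : ∀ k, Fin (N (n k)) → Bool}
    {R I : ∀ k, (Fin (N (n k)) → Bool) → ℤ}
    (hRI : ∀ {x : ∀ k, Fin (N (n k)) → Bool}, Feasible n ctx (fun k => .ofBits (x k)) →
      Feasible n ctx (fun k => encInt (R k (x k))) ∧ Feasible n ctx (fun k => encInt (I k (x k))))
    (hn : Feasible n ctx fun k => .num (n k))
    (hv : Feasible n ctx fun k => .ofBits (v k)) (hz : Feasible n ctx fun k => .ofBits (z k)) :
    Feasible n ctx fun k => encInt ((C (n k)).overlapTerm (R k) (I k) (v k) (z k)) := by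
  have hA := hC.feasible_first hn
  have hx := hA.maskBits hz
  have hx' := hC.feasible_perm_symm hn ((hC.feasible_perm hn hx).bitXor hv)
  have := ((hA.maskBits hx').bitsEq hx').intIte
    (((hRI hx).1.intMul (hRI hx').1).intAdd ((hRI hx).2.intMul (hRI hx').2))
    (hn.natConst 0).intCast
  simpa [FiveRound.overlapTerm] using this

theorem feasible_estimate (hC : Efficient C) {M B D cap Q ℓ : ℕ → ℕ}
    {R I : ∀ n, ℕ → (Fin (N n) → Bool) → ℤ}
    (hRI : ∀ {κ : Type} {n : κ → ℕ} {ctx : κ → Val} {Q : κ → ℕ} {x : ∀ k, Fin (N (n k)) → Bool},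
      Feasible n ctx (fun k => .num (n k)) → Feasible n ctx (fun k => .num (Q k)) →
      PolyBounded n Q → Feasible n ctx (fun k => .ofBits (x k)) →
      Feasible n ctx (fun k => encInt (R (n k) (Q k) (x k))) ∧
      Feasible n ctx (fun k => encInt (I (n k) (Q k) (x k))))
    {ω : ∀ k, Fin (ℓ (n k)) → Bool}
    (hn : Feasible n ctx fun k => .num (n k)) (hω : Feasible n ctx fun k => .ofBits (ω k))
    (hM : Feasible n ctx fun k => .num (M (n k))) (hMb : PolyBounded n fun k => M (n k))
    (hB : Feasible n ctx fun k => .num (B (n k))) (hBb : PolyBounded n fun k => B (n k))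
    (hD : Feasible n ctx fun k => .num (D (n k)))
    (hcap : Feasible n ctx fun k => .num (cap (n k))) (hcb : PolyBounded n fun k => cap (n k))
    (hQ : Feasible n ctx fun k => .num (Q (n k))) (hQb : PolyBounded n fun k => Q (n k)) :
    Feasible n ctx fun k => encInt ((C (n k)).estimate (M (n k)) (B (n k)) (D (n k)) (cap (n k))
      (R (n k) (Q (n k))) (I (n k) (Q (n k))) (ω k)) := by
  have hN := (hC.feasible_first hn).bitLength
  have hNb : PolyBounded n fun k => N (n k) := hC.bounded_qubits.comp n
  have hrow : ∀ {κ' : Type} {e : κ' → κ} {ctx' : κ' → Val} {r : κ' → ℕ},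
      Extends n ctx e ctx' → Feasible (fun k => n (e k)) ctx' (fun k => .num (r k)) →
      PolyBounded (fun k => n (e k)) r → Feasible (fun k => n (e k)) ctx' fun k =>
        .ofBits (tableRow (ω (e k)) (B (n (e k))) (N (n (e k))) (r k)) :=
    fun {κ' e ctx' r} he hr hrb => Feasible.tableRow (ω := fun k => ω (e k)) (he hω) (he hB)
      (hBb.comp e) (he hN) (hNb.comp e) hr hrb
  have hcand := Feasible.candidates
    (pass := fun k => (C (n k)).heavyTest (M (n k)) (B (n k)) (D (n k)) (ω k))
    hN hNb hcap hcb ?_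
  · refine hcand.sumList fun ctx' he hv => .intMul ?_ ?_
    · refine Feasible.sum_range (he hM) (hMb.comp Sigma.fst) fun ctx'' he' hj => ?_
      have hjb := he'.bounded_counter (hMb.comp Sigma.fst)
      have hz := hrow (he.trans he') ((hj.natConst 2).mul hj) ((PolyBounded.const _ 2).mul hjb)
      exact (hC.feasible_outSign ((he.trans he') hn) hz).intMul ((he' hv).character hz)
    · refine Feasible.sum_range (he hM) (hMb.comp Sigma.fst) fun ctx'' he' hj => ?_
      have hjb := he'.bounded_counter (hMb.comp Sigma.fst)
      have hz := hrow (he.trans he') ((hj.natConst 2).mul hj) ((PolyBounded.const _ 2).mul hjb)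
      exact hC.feasible_overlapTerm (hRI ((he.trans he') hn) ((he.trans he') hQ)
        ((hQb.comp Sigma.fst).comp Sigma.fst)) ((he.trans he') hn) (he' hv) hz
  · intro κ' e ctx' c α he hc hα
    refine (he hM).intCast.intLe (.intMul ?_ (Feasible.sum_range (he hM) (hMb.comp e)
      fun ctx'' he' hj => ?_))
    · have := (((he hD).natConst 2).mul ((he hD).mul (he hD))).intCast
      simpa [pow_two] using this
    · have hjb := he'.bounded_counter (hMb.comp e)
      have hjb' := (PolyBounded.const _ 2).mul hjb
      have hj' := (hj.natConst 2).mul hj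
      exact hC.feasible_weightTerm ((he.trans he') hn) (he' hc) (he' hα)
        (hrow (he.trans he') hj' hjb')
        (hrow (he.trans he') (hj'.add (hj.natConst 1)) (hjb'.add (.const _ 1)))

end Efficient

open scoped ComplexConjugate

/-! ### Fourier analysis on bit strings -/

theorem sum_prod_bits {K ι : Type} [CommSemiring K] [Fintype ι] [DecidableEq ι]
    (f : ι → Bool → K) : ∑ x : ι → Bool, ∏ i, f i (x i) = ∏ i, (f i false + f i true) := by
  rw [← Fintype.piFinset_univ, ← Finset.prod_univ_sum]
  exact Finset.prod_congr rfl fun i _ => by simp [add_comm]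

section Character

variable {N : ℕ} (u v w x y : Fin N → Bool) (c : ℕ)

theorem character_eq_prod : character v x = ∏ i, (-1) ^ (v i && x i).toNat :=
  (Finset.prod_pow_eq_pow_sum _ _ _).symm

theorem character_comm : character v x = character x v := by
  simp only [character, Bool.and_comm]

theorem character_bitXor_right : character v (bitXor x y) = character v x * character v y := by
  simp only [character_eq_prod, ← Finset.prod_mul_distrib]
  refine Finset.prod_congr rfl fun i _ => ?_
  unfold bitXor
  cases v i <;> cases x i <;> cases y i <;> simp

theorem character_bitXor_left : character (bitXor u v) x = character u x * character v x := by
  rw [character_comm, character_bitXor_right, character_comm x u, character_comm x v]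

theorem character_highBits : character v (highBits c w) = character (highBits c v) w := by
  simp only [character, highBits]
  congr 1
  refine Finset.sum_congr rfl fun i _ => ?_
  cases v i <;> simp

theorem bitXor_eq_zero_iff : bitXor u v = (fun _ => false) ↔ u = v := by
  simp only [funext_iff, bitXor]
  exact forall_congr' fun i => by cases u i <;> cases v i <;> simp

theorem bitXor_bitXor_cancel : bitXor (bitXor u v) v = u := by
  funext i
  simp [bitXor]

theorem sum_character :
    ∑ x, (character v x : ℝ) = if v = (fun _ => false) then 2 ^ N else 0 := by
  simp only [character_eq_prod, Int.cast_prod, Int.cast_pow, Int.cast_neg, Int.cast_one]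
  rw [sum_prod_bits fun i b => (-1 : ℝ) ^ (v i && b).toNat]
  split_ifs with h
  · subst h
    norm_num
  · obtain ⟨i, hi⟩ : ∃ i, v i = true := by
      by_contra! h'
      exact h (funext fun i => by simpa using h' i)
    exact Finset.prod_eq_zero (Finset.mem_univ i) (by simp [hi])

theorem sum_character_mul_character :
    ∑ x, (character u x * character v x : ℝ) = if u = v then 2 ^ N else 0 := by
  simp only [← Int.cast_mul, ← character_bitXor_left, sum_character, bitXor_eq_zero_iff]

end Character

namespace FiveRound

variable {N : ℕ} (C : FiveRound N)

/-- The normalized Fourier coefficient of the output sign, as a function of all the `N` bits. -/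
noncomputable def outCoeff (v : Fin N → Bool) : ℝ := (∑ z, (C.coeffTerm v z : ℝ)) / 2 ^ N

/-- Fourier inversion. -/
theorem outSign_eq_sum (x : Fin N → Bool) :
    (C.outSign x : ℝ) = ∑ v, C.outCoeff v * character v x := by
  simp only [outCoeff, coeffTerm, div_mul_eq_mul_div, ← Finset.sum_div, Int.cast_mul,
    Finset.sum_mul]
  rw [Finset.sum_comm]
  simp only [mul_assoc, ← Finset.mul_sum]
  have : ∀ z : Fin N → Bool, ∑ v, (character v z * character v x : ℝ) =
      if z = x then 2 ^ N else 0 := fun z => by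
    rw [← sum_character_mul_character]
    simp only [character_comm]
  simp only [this, mul_ite, mul_zero, Finset.sum_ite_eq', Finset.mem_univ, if_true]
  field_simp

/-- The autocorrelation of the output sign in terms of its Fourier coefficients. -/
theorem outSign_mul_sum (d : Fin N → Bool) :
    ∑ z, (C.outSign z : ℝ) * C.outSign (bitXor z d) =
      2 ^ N * ∑ v, C.outCoeff v ^ 2 * character v d := by
  have h1 : ∀ z, (C.outSign z : ℝ) * C.outSign (bitXor z d) =
      ∑ v, C.outCoeff v * character v d * (C.coeffTerm v z : ℝ) := by
    intro z
    rw [C.outSign_eq_sum (bitXor z d), Finset.mul_sum]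
    refine Finset.sum_congr rfl fun v _ => ?_
    rw [character_bitXor_right, coeffTerm]
    push_cast
    ring
  simp only [h1]
  rw [Finset.sum_comm, Finset.mul_sum]
  refine Finset.sum_congr rfl fun v _ => ?_
  rw [← Finset.mul_sum]
  have : ∑ z, (C.coeffTerm v z : ℝ) = 2 ^ N * C.outCoeff v := by
    rw [outCoeff]
    field_simp
  rw [this]
  ring

/-- The sum of the squares of the Fourier coefficients at the bit strings that agree with `α` on the
bits from number `c` on. -/
noncomputable def weight (c : ℕ) (α : Fin N → Bool) : ℝ :=
  ∑ v, if highBits c v = highBits c α then C.outCoeff v ^ 2 else 0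

/-- The correlation with a random shift `highBits c w` is a sum of squares of Fourier coefficients,
and the average of `character α (highBits c w)` against it picks out those that agree with `α`. -/
theorem sum_weightTerm (c : ℕ) (α : Fin N → Bool) :
    ∑ z, ∑ w, (C.weightTerm c α z w : ℝ) = 2 ^ N * 2 ^ N * C.weight c α := by
  rw [Finset.sum_comm]
  simp only [weightTerm, Int.cast_mul, ← Finset.sum_mul, outSign_mul_sum]
  have h : ∀ v w : Fin N → Bool, (character v (highBits c w) : ℝ) * character α (highBits c w) =
      character (highBits c v) w * character (highBits c α) w := by
    intro v w
    rw [character_highBits, character_highBits]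
  have h' : ∀ w : Fin N → Bool, (2 ^ N * ∑ v, C.outCoeff v ^ 2 * character v (highBits c w)) *
      (character α (highBits c w) : ℝ) = 2 ^ N * ∑ v, C.outCoeff v ^ 2 *
        (character (highBits c v) w * character (highBits c α) w) := by
    intro w
    rw [mul_assoc, Finset.sum_mul]
    simp only [mul_assoc, h]
  simp only [h', ← Finset.mul_sum]
  rw [Finset.sum_comm]
  simp only [← Finset.mul_sum, sum_character_mul_character]
  rw [weight, mul_assoc]
  congr 1
  rw [Finset.mul_sum]
  refine Finset.sum_congr rfl fun v _ => ?_
  split_ifs <;> ring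

theorem sq_outCoeff_le_weight (c : ℕ) (v : Fin N → Bool) :
    C.outCoeff v ^ 2 ≤ C.weight c (highBits c v) := by
  have h0 : highBits c (highBits c v) = highBits c v := by
    funext i
    simp [highBits]
  rw [weight, h0]
  refine le_trans ?_ (Finset.single_le_sum
    (f := fun u => if highBits c u = highBits c v then C.outCoeff u ^ 2 else 0)
    (fun u _ => by positivity) (Finset.mem_univ v))
  simp

theorem exists_outCoeff_ne_zero {c : ℕ} {α : Fin N → Bool} (h : C.weight c α ≠ 0) :
    ∃ v, C.outCoeff v ≠ 0 ∧ highBits c v = highBits c α := by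
  obtain ⟨v, _, hv⟩ := Finset.exists_ne_zero_of_sum_ne_zero h
  refine ⟨v, ?_⟩
  split_ifs at hv with hc
  · exact ⟨by simpa using hv, hc⟩
  · exact absurd rfl hv

/-- The Fourier transform of a function that depends on the bits in `S` only. -/
theorem sum_coeffTerm (v : Fin N → Bool) :
    ∑ z, (C.coeffTerm v z : ℝ) =
      fourierCoeff C.g (fun i : C.S => v i) *
        ∑ b : {i // i ∉ C.S} → Bool, (-1 : ℝ) ^ ∑ i : {i // i ∉ C.S}, (v i && b i).toNat := by
  rw [fourierCoeff, Finset.sum_mul_sum, ← Fintype.sum_prod_type',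
    ← (Equiv.piEquivPiSubtypeProd (fun i => i ∈ C.S) fun _ => Bool).sum_comp]
  refine Finset.sum_congr rfl fun z _ => ?_
  have h := Fintype.sum_subtype_add_sum_subtype (fun i => i ∈ C.S) fun i => (v i && z i).toNat
  rw [coeffTerm, outSign, character, ← pow_add, ← pow_add, ← h]
  push_cast
  congr 1
  simp only [Equiv.piEquivPiSubtypeProd_apply]
  rw [← add_assoc, add_comm (C.g fun i => z i).toNat]
  congr!

theorem maskBits_of_outCoeff_ne_zero {v : Fin N → Bool} (h : C.outCoeff v ≠ 0) :
    maskBits C.S v = v := by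
  by_contra hv
  obtain ⟨i, hi⟩ := Function.ne_iff.1 hv
  have hi : i ∉ C.S ∧ v i = true := by
    by_cases hS : i ∈ C.S <;> simp [maskBits, hS] at hi ⊢
    exact hi
  apply h
  simp only [outCoeff, sum_coeffTerm, ← Finset.prod_pow_eq_pow_sum]
  rw [sum_prod_bits fun (i : {i // i ∉ C.S}) b => (-1 : ℝ) ^ (v i && b).toNat,
    Finset.prod_eq_zero (Finset.mem_univ (⟨i, hi.1⟩ : {i // i ∉ C.S})) (by simp [hi.2])]
  simp

/-- Passing from functions of the bits in `S` to functions of all the bits does not increase the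
number of nonzero Fourier coefficients. -/
theorem card_outCoeff_ne_zero_le :
    (Finset.univ.filter fun v => C.outCoeff v ≠ 0).card ≤ sparseness C.g := by
  have h0 : ∀ v, C.outCoeff v ≠ 0 → fourierCoeff C.g (fun i : C.S => v i) ≠ 0 := by
    intro v hv h
    apply hv
    rw [outCoeff, sum_coeffTerm, h]
    simp
  rw [sparseness, ← Set.ncard_coe_finset]
  refine Set.ncard_le_ncard_of_injOn (fun v (i : C.S) => v i) (fun v hv => h0 v (by simpa using hv))
    (fun u hu v hv huv => ?_) (Set.toFinite _)
  rw [← C.maskBits_of_outCoeff_ne_zero (v := u) (by simpa using hu),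
    ← C.maskBits_of_outCoeff_ne_zero (v := v) (by simpa using hv)]
  funext i
  by_cases hi : i ∈ C.S
  · have := congrFun huv ⟨i, hi⟩
    simpa [maskBits, hi] using this
  · simp [maskBits, hi]

/-! ### The expectation value in terms of Fourier coefficients -/

/-- The coefficients of a unitary basis-preserving operator are phases. -/
theorem norm_gamma (x : Fin N → Bool) : ‖C.γ x‖ = 1 := by
  have h := congrFun (congrFun (Matrix.mem_unitaryGroup_iff'.1 C.unitary) x) x
  simp only [Matrix.mul_apply, Matrix.star_apply, basisPreserving, Matrix.one_apply_eq] at h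
  rw [Finset.sum_eq_single (C.π x) (fun y _ hy => by simp [hy]) (by simp)] at h
  simp only [if_true] at h
  have h2 : ((‖C.γ x‖ : ℂ)) ^ 2 = 1 := by
    rw [← Complex.conj_mul']
    exact h
  have h3 : ‖C.γ x‖ ^ 2 = 1 := by exact_mod_cast h2
  exact (pow_eq_one_iff_of_nonneg (norm_nonneg _) two_ne_zero).1 h3

/-- The expectation value of the Pauli operator `X ^ v` in the state after the second round. -/
noncomputable def overlap (v : Fin N → Bool) : ℝ :=
  (∑ z, C.overlapTerm (fun x => (C.γ x).re) (fun x => (C.γ x).im) v z) / 2 ^ N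

theorem abs_overlapTerm_le (v z : Fin N → Bool) :
    |C.overlapTerm (fun x => (C.γ x).re) (fun x => (C.γ x).im) v z| ≤ 1 := by
  unfold overlapTerm
  dsimp only
  split
  · generalize maskBits C.A z = x
    generalize C.π.symm (bitXor (C.π x) v) = x'
    have h : (C.γ x).re * (C.γ x').re + (C.γ x).im * (C.γ x').im =
        (conj (C.γ x) * C.γ x').re := by simp
    rw [h]
    refine (Complex.abs_re_le_norm _).trans ?_
    simp [norm_gamma]
  · simp


/-- The amplitudes of the state after the first round. -/
noncomputable def amplitude (x : Fin N → Bool) : ℝ :=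
  if maskBits C.A x = x then (Real.sqrt 2)⁻¹ ^ C.A.card else 0

/-- The product form of the indicator function of the strings that vanish outside `A`. -/
theorem prod_ite_mem_or {K : Type} [CommSemiring K] (A : Finset (Fin N)) (x : Fin N → Bool)
    (a : K) :
    ∏ i, (if i ∈ A then a else if x i = false then 1 else 0) =
      if maskBits A x = x then a ^ A.card else 0 := by
  split_ifs with h
  · have h' : ∀ i, (if i ∈ A then a else if x i = false then 1 else 0) =
        if i ∈ A then a else 1 := by
      intro i
      have := congrFun h i
      by_cases hi : i ∈ A
      · simp [hi]
      · simp [maskBits, hi] at this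
        simp [this]
    simp only [h', Finset.prod_ite_mem, Finset.univ_inter, Finset.prod_const]
  · obtain ⟨i, hi⟩ := Function.ne_iff.1 h
    refine Finset.prod_eq_zero (Finset.mem_univ i) ?_
    by_cases hS : i ∈ A
    · simp [maskBits, hS] at hi
    · simp [maskBits, hS] at hi
      simp [hS, ← hi]

theorem hadamardOn_mulVec_zero (x : Fin N → Bool) :
    Matrix.mulVec (hadamardOn C.A) (Pi.single (fun _ => false) 1) x = C.amplitude x := by
  have h := prod_ite_mem_or C.A x ((Real.sqrt 2 : ℂ)⁻¹)
  rw [Matrix.mulVec_single_one]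
  simp only [Matrix.col_apply, hadamardOn]
  have h' : (C.amplitude x : ℂ) =
      if maskBits C.A x = x then (Real.sqrt 2 : ℂ)⁻¹ ^ C.A.card else 0 := by
    rw [amplitude]
    split_ifs <;> simp
  rw [h', ← h]
  refine Finset.prod_congr rfl fun i _ => ?_
  by_cases hi : i ∈ C.A
  · simp [hi, hadamard]
  · simp [hi, Matrix.one_apply]

/-- A uniformly random string, masked with `A`, has the distribution given by the squares of the
amplitudes. -/
theorem sum_maskBits (F : (Fin N → Bool) → ℝ) :
    ∑ z, F (maskBits C.A z) = 2 ^ N * ∑ x, C.amplitude x ^ 2 * F x := by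
  have h : ∀ x, ∑ z, (if maskBits C.A z = x then 1 else 0 : ℝ) = 2 ^ N * C.amplitude x ^ 2 := by
    intro x
    have h1 : ∀ z, (if maskBits C.A z = x then 1 else 0 : ℝ) =
        ∏ i, if (decide (i ∈ C.A) && z i) = x i then 1 else 0 := by
      intro z
      rw [Finset.prod_ite_zero]
      simp [funext_iff, maskBits]
    simp only [h1]
    rw [sum_prod_bits fun i b => if (decide (i ∈ C.A) && b) = x i then (1 : ℝ) else 0]
    have h2 : C.amplitude x ^ 2 = ∏ i, if i ∈ C.A then (1 / 2 : ℝ) else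
        if x i = false then 1 else 0 := by
      rw [prod_ite_mem_or, amplitude]
      split_ifs
      · rw [← pow_mul, mul_comm, pow_mul]
        norm_num
      · norm_num
    rw [h2]
    have h3 : (2 : ℝ) ^ N = ∏ _i : Fin N, 2 := by simp
    rw [h3, ← Finset.prod_mul_distrib]
    refine Finset.prod_congr rfl fun i _ => ?_
    by_cases hi : i ∈ C.A <;> cases x i <;> norm_num [hi]
  calc ∑ z, F (maskBits C.A z)
      = ∑ z, ∑ x, (if maskBits C.A z = x then 1 else 0 : ℝ) * F x := by simp
    _ = ∑ x, (∑ z, (if maskBits C.A z = x then 1 else 0 : ℝ)) * F x := by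
        rw [Finset.sum_comm]
        simp only [Finset.sum_mul]
    _ = _ := by
        simp only [h, Finset.mul_sum, mul_assoc]

/-- The state after the second round. -/
noncomputable def midState (y : Fin N → Bool) : ℂ :=
  C.γ (C.π.symm y) * C.amplitude (C.π.symm y)

theorem finalState_apply (x : Fin N → Bool) :
    C.finalState x = ∑ y, hadamardOn C.S x y * C.midState y := by
  rw [finalState, Matrix.mulVec, dotProduct]
  refine Finset.sum_congr rfl fun y _ => ?_
  congr 1
  rw [Matrix.mulVec, dotProduct, Finset.sum_eq_single (C.π.symm y)]
  · rw [hadamardOn_mulVec_zero]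
    simp [basisPreserving, midState]
  · intro z _ hz
    have : y ≠ C.π z := fun h => hz (by simp [h])
    simp [basisPreserving, this]
  · simp

theorem hadamard_mul_hadamard (a b : Bool) :
    conj (hadamard false a) * hadamard false b + conj (hadamard true a) * hadamard true b =
      if a = b then 1 else 0 := by
  have h : ((Real.sqrt 2 : ℂ)) * (Real.sqrt 2 : ℂ) = 2 := by
    rw [← Complex.ofReal_mul, Real.mul_self_sqrt (by norm_num)]
    norm_num
  have h0 : (Real.sqrt 2 : ℂ) ≠ 0 := by
    intro h0
    simp [h0] at h
  have h' : (Real.sqrt 2 : ℂ)⁻¹ * (Real.sqrt 2 : ℂ)⁻¹ = 1 / 2 := by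
    rw [← mul_inv, h]
    norm_num
  cases a <;> cases b <;> simp [hadamard, h'] <;> norm_num

theorem hadamardOn_orthogonal (A : Finset (Fin N)) (y y' : Fin N → Bool) :
    ∑ x, conj (hadamardOn A x y) * hadamardOn A x y' = if y = y' then 1 else 0 := by
  simp only [hadamardOn, map_prod, ← Finset.prod_mul_distrib]
  rw [sum_prod_bits fun i b => conj ((if i ∈ A then hadamard else 1) b (y i)) *
    (if i ∈ A then hadamard else 1) b (y' i)]
  have : ∀ i, conj ((if i ∈ A then hadamard else 1) false (y i)) *
      (if i ∈ A then hadamard else 1) false (y' i) +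
      conj ((if i ∈ A then hadamard else 1) true (y i)) *
      (if i ∈ A then hadamard else 1) true (y' i) = if y i = y' i then 1 else 0 := by
    intro i
    by_cases hi : i ∈ A
    · simp only [hi, if_true]
      exact hadamard_mul_hadamard _ _
    · simp only [hi, if_false]
      cases y i <;> cases y' i <;> simp
  simp only [this]
  rw [Finset.prod_ite_zero]
  simp [funext_iff]

/-- A diagonal Pauli operator becomes a bit flip when it is moved through Hadamard gates. -/
theorem character_mul_hadamardOn {A : Finset (Fin N)} {v : Fin N → Bool} (hv : maskBits A v = v)
    (x y : Fin N → Bool) :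
    (character v x : ℂ) * hadamardOn A x y = hadamardOn A x (bitXor y v) := by
  rw [character_eq_prod, hadamardOn, hadamardOn]
  push_cast
  rw [← Finset.prod_mul_distrib]
  refine Finset.prod_congr rfl fun i _ => ?_
  have := congrFun hv i
  by_cases hi : i ∈ A
  · simp only [hi, if_true, hadamard, bitXor]
    cases v i <;> cases x i <;> cases y i <;> simp
  · simp [maskBits, hi] at this
    simp [this, bitXor]

/-- The expectation value of `Z ^ v` in the final state is the one of `X ^ v` in the state before
the Hadamard gates of the third round. -/
theorem sum_character_mul_normSq_finalState {v : Fin N → Bool} (hv : maskBits C.S v = v) :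
    ∑ x, (character v x : ℂ) * (conj (C.finalState x) * C.finalState x) =
      ∑ y, conj (C.midState y) * C.midState (bitXor y v) := by
  have h1 : ∀ x, (character v x : ℂ) * C.finalState x =
      ∑ y, hadamardOn C.S x y * C.midState (bitXor y v) := by
    intro x
    rw [finalState_apply, Finset.mul_sum, ← (show Function.Involutive fun y => bitXor y v from
      fun y => bitXor_bitXor_cancel y v).toPerm.sum_comp Finset.univ _ (by simp)]
    refine Finset.sum_congr rfl fun y _ => ?_
    rw [← mul_assoc, character_mul_hadamardOn hv]
    simp [bitXor_bitXor_cancel]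
  calc _ = ∑ x, ∑ y, ∑ y', conj (C.midState y) * C.midState (bitXor y' v) *
        (conj (hadamardOn C.S x y) * hadamardOn C.S x y') := by
        refine Finset.sum_congr rfl fun x _ => ?_
        rw [mul_left_comm, h1, finalState_apply, map_sum, Finset.sum_mul_sum]
        refine Finset.sum_congr rfl fun y _ => Finset.sum_congr rfl fun y' _ => ?_
        rw [map_mul]
        ring
    _ = ∑ y, ∑ y', conj (C.midState y) * C.midState (bitXor y' v) *
        ∑ x, (conj (hadamardOn C.S x y) * hadamardOn C.S x y') := by
        rw [Finset.sum_comm]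
        refine Finset.sum_congr rfl fun y _ => ?_
        rw [Finset.sum_comm]
        simp only [Finset.mul_sum]
    _ = _ := by simp [hadamardOn_orthogonal]

theorem overlap_eq (v : Fin N → Bool) :
    C.overlap v = (∑ y, conj (C.midState y) * C.midState (bitXor y v)).re := by
  let F : (Fin N → Bool) → ℝ := fun x =>
    if maskBits C.A (C.π.symm (bitXor (C.π x) v)) = C.π.symm (bitXor (C.π x) v) then
      (C.γ x).re * (C.γ (C.π.symm (bitXor (C.π x) v))).re +
        (C.γ x).im * (C.γ (C.π.symm (bitXor (C.π x) v))).im else 0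
  have h : ∑ z, C.overlapTerm (fun x => (C.γ x).re) (fun x => (C.γ x).im) v z =
      ∑ z, F (maskBits C.A z) := rfl
  rw [overlap, h, sum_maskBits, mul_div_cancel_left₀ _ (by positivity), Complex.re_sum,
    ← Equiv.sum_comp C.π fun y => (conj (C.midState y) * C.midState (bitXor y v)).re]
  refine Finset.sum_congr rfl fun x _ => ?_
  simp only [F, midState, Equiv.symm_apply_apply, amplitude]
  generalize (Real.sqrt 2)⁻¹ ^ C.A.card = a
  split_ifs <;> simp
  ring

theorem expectation_eq_sum : C.expectation = ∑ v, C.outCoeff v * C.overlap v := by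
  have h1 : C.expectation = ∑ x, (C.outSign x : ℝ) * ‖C.finalState x‖ ^ 2 := by
    simp only [expectation, prob, Finset.sum_mul]
    rw [Finset.sum_comm]
    refine Finset.sum_congr rfl fun x _ => ?_
    simp only [ite_mul, zero_mul, Finset.sum_ite_eq, Finset.mem_univ, if_true]
    rw [outSign]
    push_cast
    ring
  rw [h1]
  simp only [outSign_eq_sum, Finset.sum_mul, mul_assoc]
  rw [Finset.sum_comm]
  refine Finset.sum_congr rfl fun v _ => ?_
  rw [← Finset.mul_sum]
  by_cases hv : C.outCoeff v = 0
  · simp [hv]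
  · rw [overlap_eq, ← C.sum_character_mul_normSq_finalState (C.maskBits_of_outCoeff_ne_zero hv),
      Complex.re_sum]
    congr 1
    refine Finset.sum_congr rfl fun x _ => ?_
    rw [Complex.conj_mul']
    norm_cast

end FiveRound

/-! ### Correctness of the search -/

section Search

variable {N : ℕ}

theorem highBits_of_le {c : ℕ} (hc : N ≤ c) (v : Fin N → Bool) :
    highBits c v = fun _ => false := by
  funext i
  have := i.2
  simp [highBits, show ¬ c ≤ i by omega]

theorem highBits_zero (v : Fin N → Bool) : highBits 0 v = v := by
  funext i
  simp [highBits]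

theorem highBits_highBits_succ (c : ℕ) (v : Fin N → Bool) :
    highBits c (highBits (c + 1) v) = highBits (c + 1) v := by
  funext i
  by_cases h : c + 1 ≤ i
  · simp [highBits, h, show c ≤ i by omega]
  · simp [highBits, h]

theorem highBits_setBit (c : ℕ) (v : Fin N → Bool) :
    highBits c (setBit c v) = setBit c (highBits c v) := by
  funext i
  by_cases h : c = i
  · simp [highBits, setBit, h]
  · simp [highBits, setBit, h]

theorem highBits_eq_or (c : ℕ) (v : Fin N → Bool) :
    highBits c v = highBits (c + 1) v ∨ highBits c v = setBit c (highBits (c + 1) v) := by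
  have key : ∀ i : Fin N, c ≠ i → (c ≤ i ↔ c + 1 ≤ i) := fun i hi => by omega
  by_cases h : ∃ i : Fin N, c = i ∧ v i = true
  · obtain ⟨j, hj, hv⟩ := h
    right
    funext i
    by_cases hi : c = i
    · have : i = j := Fin.ext (by omega)
      simp [highBits, setBit, hi, this, hv]
    · simp [highBits, setBit, hi, key i hi]
  · left
    funext i
    by_cases hi : c = i
    · have : v i = false := by
        by_contra hv
        exact h ⟨i, hi, by simpa using hv⟩
      simp [highBits, this]
    · simp [highBits, key i hi]

/-- If every tested bit string that is the end of a string in `big` passes, and only ends of strings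
in `supp` pass, then the search finds all the ends of strings in `big`. -/
theorem candidates_spec {pass : ℕ → (Fin N → Bool) → Bool} {cap : ℕ} {big : Set (Fin N → Bool)}
    {supp : Finset (Fin N → Bool)} (hcap : supp.card ≤ cap)
    (hbig : ∀ c < N, ∀ v ∈ big, pass c (highBits c v) = true)
    (hsupp : ∀ c < N, ∀ α, pass c α = true → ∃ v ∈ supp, highBits c v = highBits c α) :
    ∀ d ≤ N, (candidates pass cap d).Nodup ∧
      (∀ α ∈ candidates pass cap d, highBits (N - d) α = α) ∧
      ∀ v ∈ big, highBits (N - d) v ∈ candidates pass cap d := by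
  intro d
  induction d with
  | zero =>
    intro _
    simp [candidates, highBits_of_le]
  | succ d ih =>
    intro hd
    obtain ⟨h1, h2, h3⟩ := ih (by omega)
    obtain ⟨c, hc⟩ : ∃ c, c = N - (d + 1) := ⟨_, rfl⟩
    have hc' : N - d = c + 1 := by omega
    have hcN : c < N := by omega
    rw [hc'] at h2 h3
    simp only [candidates, ← hc]
    set L := candidates pass cap d
    have hbit : ∀ α ∈ L, α ⟨c, hcN⟩ = false := by
      intro α hα
      rw [← h2 α hα]
      simp [highBits]
    have hset : ∀ α : Fin N → Bool, setBit c α ⟨c, hcN⟩ = true := by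
      intro α
      simp [setBit]
    have hfix : ∀ α ∈ L ++ L.map (setBit c), highBits c α = α := by
      intro α hα
      rw [List.mem_append, List.mem_map] at hα
      rcases hα with hα | ⟨β, hβ, rfl⟩
      · rw [← h2 α hα, highBits_highBits_succ]
      · rw [highBits_setBit, ← h2 β hβ, highBits_highBits_succ]
    have hnodup : (L ++ L.map (setBit c)).Nodup := by
      refine h1.append ((List.nodup_map_iff_inj_on h1).2 fun α hα β hβ hαβ => ?_) ?_
      · funext i
        by_cases hi : c = i
        · have : i = ⟨c, hcN⟩ := Fin.ext hi.symm
          rw [this, hbit α hα, hbit β hβ]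
        · simpa [setBit, hi] using congrFun hαβ i
      · intro α hα hα'
        obtain ⟨β, _, rfl⟩ := List.mem_map.1 hα'
        have := hbit _ hα
        rw [hset] at this
        exact absurd this (by simp)
    -- different candidates are ends of different elements of `supp`, so that nothing is discarded
    have hlen : ((L ++ L.map (setBit c)).filter (pass c)).length ≤ cap := by
      rw [← List.toFinset_card_of_nodup (hnodup.filter _)]
      refine le_trans (Finset.card_le_card ?_)
        ((Finset.card_image_le (s := supp) (f := highBits c)).trans hcap)
      intro α hα
      rw [List.mem_toFinset, List.mem_filter] at hα
      obtain ⟨v, hv, hv'⟩ := hsupp c hcN α hα.2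
      exact Finset.mem_image.2 ⟨v, hv, hv'.trans (hfix α hα.1)⟩
    rw [if_pos hlen]
    refine ⟨hnodup.filter _, fun α hα => hfix α (List.mem_of_mem_filter hα), fun v hv => ?_⟩
    refine List.mem_filter.2 ⟨?_, hbig c hcN v hv⟩
    rw [List.mem_append, List.mem_map]
    rcases highBits_eq_or c v with h | h
    · exact .inl (h ▸ h3 v hv)
    · exact .inr ⟨_, h3 v hv, h.symm⟩

end Search

/-! ### The error of the estimate -/

namespace FiveRound

variable {N : ℕ} (C : FiveRound N)

/-- The empirical sums of the sample `z`, `w` of length `M` deviate by at most `M * δ` from their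
expectation values. -/
structure Accurate (M : ℕ) (δ : ℝ) (z w : ℕ → Fin N → Bool) : Prop where
  weight : ∀ c < N, ∀ α,
    |∑ j ∈ Finset.range M, (C.weightTerm c α (z j) (w j) : ℝ) - M * C.weight c α| ≤ M * δ
  coeff : ∀ v, |∑ j ∈ Finset.range M, (C.coeffTerm v (z j) : ℝ) - M * C.outCoeff v| ≤ M * δ
  overlap : ∀ v, |∑ j ∈ Finset.range M,
    C.overlapTerm (fun x => (C.γ x).re) (fun x => (C.γ x).im) v (z j) - M * C.overlap v| ≤ M * δ

theorem abs_overlap_le (v : Fin N → Bool) : |C.overlap v| ≤ 1 := by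
  rw [overlap, abs_div, abs_of_pos (by positivity : (0 : ℝ) < 2 ^ N), div_le_one (by positivity)]
  refine (Finset.abs_sum_le_sum_abs _ _).trans
    ((Finset.sum_le_card_nsmul _ _ 1 fun z _ => C.abs_overlapTerm_le v z).trans ?_)
  simp

theorem abs_coeffTerm (v z : Fin N → Bool) : |(C.coeffTerm v z : ℝ)| = 1 := by
  simp [coeffTerm, outSign, character, abs_mul]

theorem abs_weightTerm (c : ℕ) (α z w : Fin N → Bool) : |(C.weightTerm c α z w : ℝ)| = 1 := by
  simp [weightTerm, outSign, character, abs_mul]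

/-- Fixed-point approximations with the denominator `Q` of the coefficients `γ x` yield
approximations of the overlaps. -/
theorem abs_overlapTerm_sub_le {Q : ℕ} (hQ : 2 ≤ Q) {R I : (Fin N → Bool) → ℤ}
    (hR : ∀ x, |(C.γ x).re - (R x : ℝ) / Q| ≤ 2 / Q)
    (hI : ∀ x, |(C.γ x).im - (I x : ℝ) / Q| ≤ 2 / Q) (v z : Fin N → Bool) :
    |C.overlapTerm (fun x => (C.γ x).re) (fun x => (C.γ x).im) v z -
      ((C.overlapTerm R I v z : ℤ) : ℝ) / Q ^ 2| ≤ 12 / Q := by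
  have hQ' : (2 : ℝ) ≤ Q := by exact_mod_cast hQ
  have hprod : ∀ a b a' b' : ℝ, |a| ≤ 1 → |b| ≤ 1 → |a - a'| ≤ 2 / Q → |b - b'| ≤ 2 / Q →
      |a * b - a' * b'| ≤ 6 / Q := by
    intro a b a' b' ha hb haa hbb
    have h2Q : 2 / (Q : ℝ) ≤ 1 := by
      rw [div_le_one (by linarith)]
      exact hQ'
    have hb' : |b'| ≤ 2 := by
      have h := abs_sub_abs_le_abs_sub b' b
      rw [abs_sub_comm b' b] at h
      linarith
    calc |a * b - a' * b'| = |a * (b - b') + (a - a') * b'| := by ring_nf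
      _ ≤ |a| * |b - b'| + |a - a'| * |b'| := by
          rw [← abs_mul, ← abs_mul]
          exact abs_add_le _ _
      _ ≤ 1 * (2 / Q) + 2 / Q * 2 := by gcongr
      _ = 6 / Q := by ring
  have hre : ∀ x, |(C.γ x).re| ≤ 1 := fun x => (Complex.abs_re_le_norm _).trans (C.norm_gamma x).le
  have him : ∀ x, |(C.γ x).im| ≤ 1 := fun x => (Complex.abs_im_le_norm _).trans (C.norm_gamma x).le
  unfold overlapTerm
  dsimp only
  split
  · generalize maskBits C.A z = x
    generalize C.π.symm (bitXor (C.π x) v) = x'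
    have h1 := hprod _ _ _ _ (hre x) (hre x') (hR x) (hR x')
    have h2 := hprod _ _ _ _ (him x) (him x') (hI x) (hI x')
    calc _ = |((C.γ x).re * (C.γ x').re - R x / Q * (R x' / Q)) +
          ((C.γ x).im * (C.γ x').im - I x / Q * (I x' / Q))| := by
          congr 1
          push_cast
          field_simp
          ring
      _ ≤ 6 / Q + 6 / Q := (abs_add_le _ _).trans (add_le_add h1 h2)
      _ = 12 / Q := by ring
  · simp
    positivity

/-- If the sample is accurate, then the test finds all the large Fourier coefficients, and the
estimate is accurate. -/
theorem abs_estimate_sub_expectation_le {M B D cap Q ℓ P : ℕ} (hM : 0 < M) (hP : 0 < P)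
    (hcap : sparseness C.g ≤ cap) (hD : D = 8 * (cap + 1) * P) (hQ : Q = 48 * D ^ 2)
    {R I : (Fin N → Bool) → ℤ}
    (hR : ∀ x, |(C.γ x).re - (R x : ℝ) / Q| ≤ 2 / Q)
    (hI : ∀ x, |(C.γ x).im - (I x : ℝ) / Q| ≤ 2 / Q) {ω : Fin ℓ → Bool}
    (hω : C.Accurate M (1 / (4 * D ^ 2)) (fun j => tableRow ω B N (2 * j))
      fun j => tableRow ω B N (2 * j + 1)) :
    |(C.estimate M B D cap R I ω : ℝ) / ((M * Q) ^ 2 : ℕ) - C.expectation| ≤ 1 / P := by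
  obtain ⟨hweight, hcoeff, hoverlap⟩ := hω
  have hM' : (0 : ℝ) < M := by exact_mod_cast hM
  have hDpos : 8 ≤ D := by
    rw [hD]
    nlinarith [Nat.zero_le cap, Nat.zero_le (cap * P)]
  have hD' : (8 : ℝ) ≤ D := by exact_mod_cast hDpos
  have hQ2 : 2 ≤ Q := by nlinarith
  have hQ' : (0 : ℝ) < Q := by
    have : (2 : ℝ) ≤ Q := by exact_mod_cast hQ2
    linarith
  set δ : ℝ := 1 / (4 * D ^ 2) with hδ
  have hδ0 : 0 < δ := by positivity
  have hδ1 : δ ≤ 1 := by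
    rw [hδ, div_le_one (by positivity)]
    nlinarith
  -- A coefficient of absolute value at least `1 / D` has weight at least `4 * δ`, so that the
  -- empirical weight is at least `3 * δ`; the test requires `2 * δ`, which a coefficient of weight
  -- `0` cannot reach.
  have htest : ∀ c α, C.heavyTest M B D ω c α = true ↔ 2 * (M * δ) ≤ ∑ j ∈ Finset.range M,
      (C.weightTerm c α (tableRow ω B N (2 * j)) (tableRow ω B N (2 * j + 1)) : ℝ) := by
    intro c α
    rw [heavyTest, decide_eq_true_iff, ← Int.cast_le (R := ℝ)]
    push_cast
    rw [hδ, ← mul_assoc, mul_one_div, div_le_iff₀ (by positivity)]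
    constructor <;> intro h <;> linarith
  obtain ⟨hnodup, -, hmem⟩ := candidates_spec (pass := C.heavyTest M B D ω) (cap := cap)
    (big := {v | 1 / (D : ℝ) ≤ |C.outCoeff v|})
    (supp := Finset.univ.filter fun v => C.outCoeff v ≠ 0)
    (C.card_outCoeff_ne_zero_le.trans hcap)
    (fun c hc v hv => by
      rw [htest]
      have h1 := (abs_le.1 (hweight c hc (highBits c v))).1
      have h2 := C.sq_outCoeff_le_weight c v
      have h3 : 4 * δ ≤ C.outCoeff v ^ 2 := by
        rw [← sq_abs]
        calc 4 * δ = (1 / (D : ℝ)) ^ 2 := by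
              rw [hδ]
              field_simp
          _ ≤ _ := by
              have : 1 / (D : ℝ) ≤ |C.outCoeff v| := hv
              gcongr
      nlinarith)
    (fun c hc α hα => by
      rw [htest] at hα
      have h1 := (abs_le.1 (hweight c hc α)).2
      have h2 : C.weight c α ≠ 0 := by
        intro h
        rw [h] at h1
        nlinarith
      obtain ⟨v, hv, hv'⟩ := C.exists_outCoeff_ne_zero h2
      exact ⟨v, by simpa using hv, hv'⟩) N le_rfl
  have hlen := length_candidates_le (C.heavyTest M B D ω) cap N
  rw [estimate]
  generalize candidates (C.heavyTest M B D ω) cap N = L at hnodup hmem hlen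
  simp only [Nat.sub_self, highBits_zero, Set.mem_ofPred_eq] at hmem
  -- `a v` and `b v` are the estimates of the Fourier coefficient and of the overlap
  set a : (Fin N → Bool) → ℝ := fun v =>
    (∑ j ∈ Finset.range M, (C.coeffTerm v (tableRow ω B N (2 * j)) : ℝ)) / M
  set b : (Fin N → Bool) → ℝ := fun v =>
    (∑ j ∈ Finset.range M, ((C.overlapTerm R I v (tableRow ω B N (2 * j)) : ℤ) : ℝ)) / (M * Q ^ 2)
  have ha : ∀ v, |a v - C.outCoeff v| ≤ δ := by
    intro v
    have h : a v - C.outCoeff v = (∑ j ∈ Finset.range M,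
        (C.coeffTerm v (tableRow ω B N (2 * j)) : ℝ) - M * C.outCoeff v) / M := by
      simp only [a]
      field_simp
    rw [h, abs_div, abs_of_pos hM', div_le_iff₀ hM', mul_comm δ]
    exact hcoeff v
  have ha1 : ∀ v, |a v| ≤ 1 := by
    intro v
    simp only [a]
    rw [abs_div, abs_of_pos hM', div_le_one hM']
    refine (Finset.abs_sum_le_sum_abs _ _).trans ?_
    simp [abs_coeffTerm]
  have hb : ∀ v, |b v - C.overlap v| ≤ 2 * δ := by
    intro v
    set s := ∑ j ∈ Finset.range M, C.overlapTerm (fun x => (C.γ x).re) (fun x => (C.γ x).im) v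
      (tableRow ω B N (2 * j))
    have h1 : |s - M * Q ^ 2 * b v / Q ^ 2| ≤ M * δ := by
      have h : s - M * Q ^ 2 * b v / Q ^ 2 = ∑ j ∈ Finset.range M,
          (C.overlapTerm (fun x => (C.γ x).re) (fun x => (C.γ x).im) v (tableRow ω B N (2 * j)) -
            ((C.overlapTerm R I v (tableRow ω B N (2 * j)) : ℤ) : ℝ) / Q ^ 2) := by
        simp only [b, s]
        rw [Finset.sum_sub_distrib, ← Finset.sum_div]
        field_simp
      rw [h]
      refine (Finset.abs_sum_le_sum_abs _ _).trans ((Finset.sum_le_card_nsmul _ _ (12 / (Q : ℝ))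
        fun j _ => C.abs_overlapTerm_sub_le hQ2 hR hI _ _).trans (le_of_eq ?_))
      rw [Finset.card_range, nsmul_eq_mul, hδ, hQ]
      push_cast
      field_simp
      norm_num
    have h2 : b v - C.overlap v = ((s - M * C.overlap v) - (s - M * Q ^ 2 * b v / Q ^ 2)) / M := by
      field_simp
      ring
    rw [h2, abs_div, abs_of_pos hM', div_le_iff₀ hM']
    refine (abs_sub _ _).trans ?_
    have := hoverlap v
    linarith
  have hterm : ∀ v, |a v * b v - C.outCoeff v * C.overlap v| ≤ 3 * δ := by
    intro v
    calc _ = |a v * (b v - C.overlap v) + (a v - C.outCoeff v) * C.overlap v| := by ring_nf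
      _ ≤ |a v| * |b v - C.overlap v| + |a v - C.outCoeff v| * |C.overlap v| := by
          rw [← abs_mul, ← abs_mul]
          exact abs_add_le _ _
      _ ≤ 1 * (2 * δ) + δ * 1 := by
          gcongr
          exacts [ha1 v, hb v, ha v, C.abs_overlap_le v]
      _ = 3 * δ := by ring
  have hest : (((L.map fun v => (∑ j ∈ Finset.range M, C.coeffTerm v (tableRow ω B N (2 * j))) *
      ∑ j ∈ Finset.range M, C.overlapTerm R I v (tableRow ω B N (2 * j))).sum : ℤ) : ℝ) /
      ((M * Q) ^ 2 : ℕ) = ∑ v ∈ L.toFinset, a v * b v := by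
    rw [← List.sum_toFinset _ hnodup]
    push_cast
    rw [Finset.sum_div]
    refine Finset.sum_congr rfl fun v _ => ?_
    simp only [a, b]
    field_simp
  rw [hest, expectation_eq_sum, ← Finset.sum_add_sum_compl L.toFinset fun v =>
    C.outCoeff v * C.overlap v, ← sub_sub, ← Finset.sum_sub_distrib]
  -- There are at most `cap + 1` candidates (the bound `cap` holds after the first round only), and
  -- at most `cap` nonzero coefficients, all of them below `1 / D`, that are not candidates.
  have hin : |∑ v ∈ L.toFinset, (a v * b v - C.outCoeff v * C.overlap v)| ≤
      (cap + 1) * (3 * δ) := by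
    refine (Finset.abs_sum_le_sum_abs _ _).trans
      ((Finset.sum_le_card_nsmul _ _ (3 * δ) fun v _ => hterm v).trans ?_)
    rw [nsmul_eq_mul]
    have : ((L.toFinset.card : ℕ) : ℝ) ≤ (cap + 1 : ℕ) := by
      exact_mod_cast (List.toFinset_card_le L).trans hlen
    push_cast at this
    gcongr
  have hout : |∑ v ∈ L.toFinsetᶜ, C.outCoeff v * C.overlap v| ≤ cap * (1 / D) := by
    refine (Finset.abs_sum_le_sum_abs _ _).trans ?_
    calc ∑ v ∈ L.toFinsetᶜ, |C.outCoeff v * C.overlap v|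
        ≤ ∑ v, if C.outCoeff v ≠ 0 then (1 / D : ℝ) else 0 := by
          rw [← Finset.sum_add_sum_compl L.toFinset fun v =>
            if C.outCoeff v ≠ 0 then (1 / D : ℝ) else 0]
          refine le_add_of_nonneg_of_le (Finset.sum_nonneg fun v _ => by positivity)
            (Finset.sum_le_sum fun v hv => ?_)
          rw [abs_mul]
          split_ifs with h
          · have h1 : |C.outCoeff v| < 1 / D := by
              by_contra! h'
              simp only [Finset.mem_compl, List.mem_toFinset] at hv
              exact hv (hmem v h')
            calc |C.outCoeff v| * |C.overlap v| ≤ 1 / D * 1 := by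
                  gcongr
                  exact C.abs_overlap_le v
              _ = 1 / D := mul_one _
          · have : C.outCoeff v = 0 := by simpa using h
            simp [this]
      _ = ((Finset.univ.filter fun v => C.outCoeff v ≠ 0).card : ℝ) * (1 / D) := by
          rw [← Finset.sum_filter, Finset.sum_const, nsmul_eq_mul]
      _ ≤ cap * (1 / D) := by
          gcongr
          exact C.card_outCoeff_ne_zero_le.trans hcap
  refine (abs_sub _ _).trans ((add_le_add hin hout).trans ?_)
  have hP' : (0 : ℝ) < P := by exact_mod_cast hP
  have hδD : 3 * δ ≤ 1 / D := by
    rw [hδ, mul_one_div, div_le_div_iff₀ (by positivity) (by positivity)]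
    nlinarith
  have hDP : (D : ℝ) = 8 * (cap + 1) * P := by
    rw [hD]
    push_cast
    ring
  calc (cap + 1) * (3 * δ) + cap * (1 / D) ≤ (cap + 1 : ℝ) * (1 / D) + (cap + 1) * (1 / D) := by
        gcongr
        linarith
    _ = 1 / (4 * P) := by
        rw [hDP]
        field_simp
        norm_num
    _ ≤ 1 / P := by
        apply one_div_le_one_div_of_le hP'
        linarith

end FiveRound

/-! ### Concentration of empirical sums -/

section Chernoff

variable {R : Type} [Fintype R] [Nonempty R] {M : ℕ} {δ : ℝ}

/-- A Chernoff bound, as a count of the samples in `Fin M → R`. It follows from the estimate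
`exp t ≤ 1 + t + t ^ 2` for the moment generating function at the parameter `δ / 8`. -/
theorem card_sum_sub_gt_le {F : R → ℝ} {μ : ℝ} (hF : ∀ a, |F a| ≤ 1)
    (hμ : ∑ a, F a = Fintype.card R * μ) (hδ : 0 < δ) (hδ1 : δ ≤ 1) :
    ((Finset.univ.filter fun ω : Fin M → R => M * δ < ∑ j, F (ω j) - M * μ).card : ℝ) ≤
      (Fintype.card R : ℝ) ^ M * Real.exp (-(δ ^ 2 * M / 16)) := by
  classical
  have hR : (0 : ℝ) < Fintype.card R := by exact_mod_cast Fintype.card_pos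
  have hμ1 : |μ| ≤ 1 := by
    have h : |∑ a, F a| ≤ Fintype.card R := by
      refine (Finset.abs_sum_le_sum_abs _ _).trans
        ((Finset.sum_le_card_nsmul _ _ 1 fun a _ => hF a).trans ?_)
      simp
    rw [hμ, abs_mul, abs_of_pos hR] at h
    nlinarith
  have hmgf : ∑ a, Real.exp (δ / 8 * (F a - μ)) ≤ Fintype.card R * Real.exp (δ ^ 2 / 16) := by
    have h1 : ∀ a, Real.exp (δ / 8 * (F a - μ)) ≤ 1 + δ / 8 * (F a - μ) + δ ^ 2 / 16 := by
      intro a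
      have h2 : |F a - μ| ≤ 2 := (abs_sub _ _).trans (by linarith [hF a])
      have h3 : |δ / 8 * (F a - μ)| ≤ δ / 4 := by
        rw [abs_mul, abs_of_pos (by positivity)]
        nlinarith
      have h4 := (abs_le.1 (Real.abs_exp_sub_one_sub_id_le (h3.trans (by linarith)))).2
      have h5 : (δ / 8 * (F a - μ)) ^ 2 ≤ (δ / 4) ^ 2 := by
        rw [← sq_abs]
        gcongr
      nlinarith
    calc ∑ a, Real.exp (δ / 8 * (F a - μ)) ≤ ∑ a, (1 + δ / 8 * (F a - μ) + δ ^ 2 / 16) :=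
          Finset.sum_le_sum fun a _ => h1 a
      _ = Fintype.card R * (δ ^ 2 / 16 + 1) := by
          rw [Finset.sum_add_distrib, Finset.sum_add_distrib, ← Finset.mul_sum,
            Finset.sum_sub_distrib, hμ]
          simp
          ring
      _ ≤ _ := by
          gcongr
          exact Real.add_one_le_exp _
  have hsum : ∑ ω : Fin M → R, Real.exp (δ / 8 * (∑ j, F (ω j) - M * μ)) =
      (∑ a, Real.exp (δ / 8 * (F a - μ))) ^ M := by
    have h := Finset.prod_univ_sum (fun _ : Fin M => (Finset.univ : Finset R))
      fun _ a => Real.exp (δ / 8 * (F a - μ))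
    rw [Finset.prod_const, Finset.card_univ, Fintype.card_fin, Fintype.piFinset_univ] at h
    rw [h]
    refine Finset.sum_congr rfl fun ω _ => ?_
    rw [← Real.exp_sum, ← Finset.mul_sum, Finset.sum_sub_distrib]
    simp
  have hexp : Real.exp (-(δ ^ 2 * M / 16)) =
      Real.exp (-(δ ^ 2 * M / 8)) * Real.exp (δ ^ 2 / 16) ^ M := by
    rw [← Real.exp_nat_mul, ← Real.exp_add]
    congr 1
    ring
  calc ((Finset.univ.filter fun ω : Fin M → R => M * δ < ∑ j, F (ω j) - M * μ).card : ℝ)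
      = ∑ ω : Fin M → R, if M * δ < ∑ j, F (ω j) - M * μ then 1 else 0 := by simp
    _ ≤ ∑ ω : Fin M → R, Real.exp (-(δ ^ 2 * M / 8)) *
          Real.exp (δ / 8 * (∑ j, F (ω j) - M * μ)) := by
        refine Finset.sum_le_sum fun ω _ => ?_
        rw [← Real.exp_add]
        split_ifs with h
        · rw [Real.one_le_exp_iff]
          nlinarith
        · positivity
    _ = Real.exp (-(δ ^ 2 * M / 8)) * (∑ a, Real.exp (δ / 8 * (F a - μ))) ^ M := by
        rw [← Finset.mul_sum, hsum]
    _ ≤ Real.exp (-(δ ^ 2 * M / 8)) * (Fintype.card R * Real.exp (δ ^ 2 / 16)) ^ M := by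
        gcongr
    _ = _ := by
        rw [hexp, mul_pow]
        ring

/-- The two-sided version of the Chernoff bound. -/
theorem card_abs_sum_sub_gt_le {F : R → ℝ} {μ : ℝ} (hF : ∀ a, |F a| ≤ 1)
    (hμ : ∑ a, F a = Fintype.card R * μ) (hδ : 0 < δ) (hδ1 : δ ≤ 1) :
    ((Finset.univ.filter fun ω : Fin M → R => M * δ < |∑ j, F (ω j) - M * μ|).card : ℝ) ≤
      2 * ((Fintype.card R : ℝ) ^ M * Real.exp (-(δ ^ 2 * M / 16))) := by
  classical
  have h1 := card_sum_sub_gt_le (M := M) hF hμ hδ hδ1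
  have h2 := card_sum_sub_gt_le (M := M) (F := fun a => -F a) (μ := -μ) (by simpa using hF)
    (by rw [Finset.sum_neg_distrib, hμ]; ring) hδ hδ1
  have h3 : (Finset.univ.filter fun ω : Fin M → R => M * δ < |∑ j, F (ω j) - M * μ|) ⊆
      (Finset.univ.filter fun ω : Fin M → R => M * δ < ∑ j, F (ω j) - M * μ) ∪
      (Finset.univ.filter fun ω : Fin M → R => M * δ < ∑ j, -F (ω j) - M * -μ) := by
    intro ω hω
    simp only [Finset.mem_union, Finset.mem_filter, Finset.mem_univ, true_and,
      Finset.sum_neg_distrib] at hω ⊢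
    rcases lt_abs.1 hω with h | h
    · exact .inl h
    · exact .inr (by linarith)
  have h4 := (Finset.card_le_card h3).trans (Finset.card_union_le _ _)
  have h5 := (Nat.cast_le (α := ℝ)).2 h4
  push_cast at h5
  linarith

end Chernoff

/-! ### Uniformly random tables -/

/-- The restriction of a uniformly random bit string to some of its bits is uniformly random. -/
theorem card_filter_comp {ι κ : Type} [Fintype ι] [DecidableEq ι] [Fintype κ] [DecidableEq κ]
    {e : κ → ι} (he : Function.Injective e) (p : (κ → Bool) → Prop) [DecidablePred p] :
    (Finset.univ.filter fun ω : ι → Bool => p (ω ∘ e)).card * 2 ^ Fintype.card κ =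
      (Finset.univ.filter p).card * 2 ^ Fintype.card ι := by
  classical
  let E : (ι → Bool) ≃ (κ → Bool) × ({i // ¬ i ∈ Set.range e} → Bool) :=
    (Equiv.piEquivPiSubtypeProd (fun i => i ∈ Set.range e) fun _ => Bool).trans
      (Equiv.prodCongr ((Equiv.ofInjective e he).symm.arrowCongr (Equiv.refl Bool))
        (Equiv.refl _))
  have hE : ∀ ω, (E ω).1 = ω ∘ e := by
    intro ω
    funext k
    simp [E]
  have h1 : (Finset.univ.filter fun ω : ι → Bool => p (ω ∘ e)).card =
      (Finset.univ.filter p).card * Fintype.card ({i // ¬ i ∈ Set.range e} → Bool) := by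
    rw [← Finset.card_univ, ← Finset.card_product]
    refine Finset.card_equiv E fun ω => ?_
    simp [hE]
  have h2 : Fintype.card (ι → Bool) =
      Fintype.card (κ → Bool) * Fintype.card ({i // ¬ i ∈ Set.range e} → Bool) := by
    rw [← Fintype.card_prod]
    exact Fintype.card_congr E
  rw [Fintype.card_fun, Fintype.card_fun, Fintype.card_bool] at h2
  rw [h1, h2]
  ring

/-- The rows of a table of random bits are independent and uniformly random, even if only the first
`N` bits of each row are used. -/
theorem card_filter_tableRow {N B M : ℕ} (hB : N ≤ B)
    (p : (Fin M → (Fin N → Bool) × (Fin N → Bool)) → Prop) [DecidablePred p] :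
    ((Finset.univ.filter fun ω : Fin (2 * M * B) → Bool =>
      p fun j => (tableRow ω B N (2 * j), tableRow ω B N (2 * j + 1))).card : ℝ) / 2 ^ (2 * M * B) =
      (Finset.univ.filter p).card /
        (Fintype.card ((Fin N → Bool) × (Fin N → Bool)) : ℝ) ^ M := by
  -- the bit `(j, b, i)` of the sample is the entry `i` of row `2 * j + b`, at position
  -- `e (j, b, i)` of the table
  let E : (Fin M × Bool × Fin N → Bool) ≃ (Fin M → (Fin N → Bool) × (Fin N → Bool)) :=
    { toFun := fun x j => (fun i => x (j, false, i), fun i => x (j, true, i))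
      invFun := fun y k => if k.2.1 then (y k.1).2 k.2.2 else (y k.1).1 k.2.2
      left_inv := by
        intro x
        funext ⟨j, b, i⟩
        cases b <;> rfl
      right_inv := fun y => rfl }
  have hlt : ∀ k : Fin M × Bool × Fin N,
      (2 * (k.1 : ℕ) + k.2.1.toNat) * B + k.2.2 < 2 * M * B := by
    rintro ⟨j, b, i⟩
    have h1 := j.2
    have h2 := i.2
    have h3 : b.toNat ≤ 1 := Bool.toNat_le b
    have h4 : (2 * (j : ℕ) + b.toNat + 1) * B ≤ 2 * M * B := Nat.mul_le_mul_right B (by omega)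
    dsimp only
    rw [add_mul, one_mul] at h4
    omega
  let e : Fin M × Bool × Fin N → Fin (2 * M * B) := fun k =>
    ⟨(2 * k.1 + k.2.1.toNat) * B + k.2.2, hlt k⟩
  have he : Function.Injective e := by
    rintro ⟨j, b, i⟩ ⟨j', b', i'⟩ h
    have h1 : (2 * (j : ℕ) + b.toNat) * B + i = (2 * (j' : ℕ) + b'.toNat) * B + i' :=
      congrArg Fin.val h
    have hi : (i : ℕ) < B := i.2.trans_le hB
    have hi' : (i' : ℕ) < B := i'.2.trans_le hB
    have hrow : 2 * (j : ℕ) + b.toNat = 2 * (j' : ℕ) + b'.toNat := by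
      have hBpos : 0 < B := by omega
      have h2 := congrArg (· / B) h1
      simpa [Nat.add_div_of_dvd_right, Nat.mul_div_cancel _ hBpos, Nat.div_eq_of_lt hi,
        Nat.div_eq_of_lt hi', mul_comm _ B, Nat.mul_add_div hBpos] using h2
    have h3 : b.toNat ≤ 1 := Bool.toNat_le b
    have h4 : b'.toNat ≤ 1 := Bool.toNat_le b'
    have hb : b = b' := by
      have : b.toNat = b'.toNat := by omega
      cases b <;> cases b' <;> simp_all
    subst hb
    rw [hrow] at h1
    rw [Fin.ext (by omega : (j : ℕ) = j'), Fin.ext (by omega : (i : ℕ) = i')]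
  have hEe : ∀ ω : Fin (2 * M * B) → Bool, E (ω ∘ e) =
      fun j : Fin M => (tableRow ω B N (2 * j), tableRow ω B N (2 * j + 1)) := by
    intro ω
    funext j
    refine Prod.ext (funext fun i => ?_) (funext fun i => ?_)
    · have := hlt (j, false, i)
      simp only [Bool.toNat_false, add_zero] at this
      simp [E, e, tableRow, this]
    · have := hlt (j, true, i)
      simp only [Bool.toNat_true] at this
      simp [E, e, tableRow, this]
  have h1 := card_filter_comp he fun x => p (E x)
  simp only [hEe] at h1
  have h2 : (Finset.univ.filter fun x => p (E x)).card = (Finset.univ.filter p).card :=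
    Finset.card_equiv E (by simp)
  have h3 : (Fintype.card ((Fin N → Bool) × (Fin N → Bool)) : ℝ) ^ M =
      2 ^ Fintype.card (Fin M × Bool × Fin N) := by
    simp only [Fintype.card_prod, Fintype.card_fun, Fintype.card_bool, Fintype.card_fin]
    push_cast
    rw [← pow_add, ← pow_mul]
    congr 1
    ring
  rw [h2, Fintype.card_fin] at h1
  rw [h3, div_eq_div_iff (by positivity) (by positivity)]
  exact_mod_cast h1

namespace FiveRound

variable {N : ℕ} (C : FiveRound N)

/-- A table of random bits yields an accurate sample with high probability. -/
theorem card_not_accurate_le {B M D r : ℕ} (hB : N ≤ B) (hD : 0 < D)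
    (hM : M = 256 * (r + 2 * B + 2) * D ^ 4) :
    (Set.ncard {ω : Fin (2 * M * B) → Bool | ¬ C.Accurate M (1 / (4 * D ^ 2))
      (fun j => tableRow ω B N (2 * j)) fun j => tableRow ω B N (2 * j + 1)} : ℝ) /
        2 ^ (2 * M * B) ≤ (1 / 2) ^ r := by
  classical
  set δ : ℝ := 1 / (4 * D ^ 2) with hδ
  have hD' : (1 : ℝ) ≤ D := by exact_mod_cast hD
  have hδ0 : 0 < δ := by positivity
  have hδ1 : δ ≤ 1 := by
    rw [hδ, div_le_one (by positivity)]
    nlinarith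
  -- the statistics whose empirical sums have to be accurate, and their expectation values
  let X := (Fin N × (Fin N → Bool)) ⊕ (Fin N → Bool) ⊕ (Fin N → Bool)
  let F : X → (Fin N → Bool) × (Fin N → Bool) → ℝ
    | .inl k, a => C.weightTerm k.1 k.2 a.1 a.2
    | .inr (.inl v), a => C.coeffTerm v a.1
    | .inr (.inr v), a => C.overlapTerm (fun x => (C.γ x).re) (fun x => (C.γ x).im) v a.1
  let μ : X → ℝ
    | .inl k => C.weight k.1 k.2
    | .inr (.inl v) => C.outCoeff v
    | .inr (.inr v) => C.overlap v
  have hcard : (Fintype.card ((Fin N → Bool) × (Fin N → Bool)) : ℝ) = 2 ^ N * 2 ^ N := by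
    simp
  have hF : ∀ k a, |F k a| ≤ 1 := by
    rintro (k | v | v) a
    · exact (C.abs_weightTerm _ _ _ _).le
    · exact (C.abs_coeffTerm _ _).le
    · exact C.abs_overlapTerm_le _ _
  have hμ : ∀ k, ∑ a, F k a = Fintype.card ((Fin N → Bool) × (Fin N → Bool)) * μ k := by
    rintro (k | v | v)
    · rw [Fintype.sum_prod_type, hcard]
      exact C.sum_weightTerm _ _
    · rw [Fintype.sum_prod_type, hcard]
      simp [F, μ, outCoeff, ← Finset.mul_sum]
      field_simp
    · rw [Fintype.sum_prod_type, hcard]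
      simp [F, μ, overlap, ← Finset.mul_sum]
      field_simp
  let bad : X → (Fin M → (Fin N → Bool) × (Fin N → Bool)) → Prop := fun k y =>
    M * δ < |∑ j, F k (y j) - M * μ k|
  have hsub : {ω : Fin (2 * M * B) → Bool | ¬ C.Accurate M δ
      (fun j => tableRow ω B N (2 * j)) fun j => tableRow ω B N (2 * j + 1)} ⊆
      ((Finset.univ.filter fun ω : Fin (2 * M * B) → Bool =>
        ∃ k, bad k fun j => (tableRow ω B N (2 * j), tableRow ω B N (2 * j + 1)) : Finset _) :
          Set (Fin (2 * M * B) → Bool)) := by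
    intro ω hω
    simp only [Finset.coe_filter, Finset.mem_univ, true_and]
    by_contra hgood
    simp only [Set.mem_ofPred_eq, not_exists, bad, not_lt] at hgood
    refine hω ⟨fun c hc α => ?_, fun v => ?_, fun v => ?_⟩
    · simpa [F, μ, Finset.sum_range] using hgood (.inl (⟨c, hc⟩, α))
    · simpa [F, μ, Finset.sum_range] using hgood (.inr (.inl v))
    · simpa [F, μ, Finset.sum_range] using hgood (.inr (.inr v))
  have hbad : ((Finset.univ.filter fun y => ∃ k, bad k y).card : ℝ) ≤ Fintype.card X *
      (2 * ((Fintype.card ((Fin N → Bool) × (Fin N → Bool)) : ℝ) ^ M *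
        Real.exp (-(δ ^ 2 * M / 16)))) := by
    have h1 : (Finset.univ.filter fun y => ∃ k, bad k y) ⊆
        Finset.univ.biUnion fun k => Finset.univ.filter (bad k) := by
      intro y hy
      simpa using hy
    have h2 := (Nat.cast_le (α := ℝ)).2
      ((Finset.card_le_card h1).trans Finset.card_biUnion_le)
    push_cast at h2
    refine h2.trans ((Finset.sum_le_card_nsmul _ _ _ fun k _ =>
      card_abs_sum_sub_gt_le (hF k) (hμ k) hδ0 hδ1).trans (le_of_eq ?_))
    rw [nsmul_eq_mul, Finset.card_univ]
  -- there are `(N + 2) * 2 ^ N` statistics, whence the summand `2 * B` in the choice of `M`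
  have hX : (Fintype.card X : ℝ) ≤ 2 ^ (2 * B + 1) := by
    have h1 : Fintype.card X = (N + 2) * 2 ^ N := by
      simp [X]
      ring
    have h2 : N + 2 ≤ 2 ^ (N + 1) := Nat.lt_two_pow_self
    have h3 : (N + 2) * 2 ^ N ≤ 2 ^ (2 * B + 1) := by
      calc (N + 2) * 2 ^ N ≤ 2 ^ (N + 1) * 2 ^ N := Nat.mul_le_mul_right _ h2
        _ = 2 ^ (N + 1 + N) := (pow_add _ _ _).symm
        _ ≤ 2 ^ (2 * B + 1) := Nat.pow_le_pow_right (by norm_num) (by omega)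
    rw [h1]
    exact_mod_cast h3
  have hexp : Real.exp (-(δ ^ 2 * M / 16)) ≤ (1 / 2) ^ (r + 2 * B + 2) := by
    have h1 : δ ^ 2 * M / 16 = (r + 2 * B + 2 : ℕ) := by
      rw [hδ, hM]
      push_cast
      field_simp
      norm_num
    rw [h1, Real.exp_neg, ← Real.exp_one_pow, one_div, inv_pow]
    gcongr
    linarith [Real.add_one_le_exp 1]
  have hpos : (0 : ℝ) < (Fintype.card ((Fin N → Bool) × (Fin N → Bool)) : ℝ) ^ M := by
    rw [hcard]
    positivity
  calc _ ≤ ((Finset.univ.filter fun ω : Fin (2 * M * B) → Bool =>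
        ∃ k, bad k fun j => (tableRow ω B N (2 * j), tableRow ω B N (2 * j + 1))).card : ℝ) /
        2 ^ (2 * M * B) := by
        gcongr
        rw [← Set.ncard_coe_finset]
        exact Set.ncard_le_ncard hsub (Set.toFinite _)
    _ ≤ Fintype.card X * (2 * Real.exp (-(δ ^ 2 * M / 16))) := by
        rw [card_filter_tableRow hB fun y => ∃ k, bad k y, div_le_iff₀ hpos]
        refine hbad.trans (le_of_eq ?_)
        ring
    _ ≤ 2 ^ (2 * B + 1) * (2 * (1 / 2) ^ (r + 2 * B + 2)) := by
        gcongr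
    _ = (1 / 2) ^ r := by
        rw [pow_add, pow_add (1 / 2 : ℝ) (r + 2 * B), pow_add (1 / 2 : ℝ) r, div_pow, div_pow]
        field_simp
        norm_num

end FiveRound

end QSim

/-- If the Boolean functions computed in the classical postprocessing of a uniform family of
efficient five-round circuits have polynomially many nonzero Fourier coefficients, then the output
of the circuits can be simulated efficiently classically. -/
theorem theorem2 (N : ℕ → ℕ) (C : ∀ n, QSim.FiveRound (N n)) (hC : QSim.Efficient C)
    (hg : ∃ s : Polynomial ℕ, ∀ n, QSim.sparseness (C n).g ≤ s.eval n) :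
    QSim.PolyApproximable (fun n => (C n).expectation) := by
  intro p r
  obtain ⟨s, hs⟩ := hg
  obtain ⟨B, hB⟩ := hC.bounded_qubits
  obtain ⟨R, I, hγ, hRI⟩ := hC.exists_phase
  -- `D` is the inverse of the threshold for Fourier coefficients, `Q` is the common denominator of
  -- the approximations to the phases, `M` is the number of samples, and `B` is the length of a row
  let D : Polynomial ℕ := 8 * (s + 1) * (p + 1)
  let Q : Polynomial ℕ := 48 * D ^ 2
  let M : Polynomial ℕ := 256 * (r + 2 * B + 2) * D ^ 4
  let ℓ : Polynomial ℕ := 2 * M * B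
  have hD : ∀ n, D.eval n = 8 * (s.eval n + 1) * (p.eval n + 1) := by simp [D]
  have hQ : ∀ n, Q.eval n = 48 * D.eval n ^ 2 := by simp [Q]
  have hM : ∀ n, M.eval n = 256 * (r.eval n + 2 * B.eval n + 2) * D.eval n ^ 4 := by simp [M]
  have hℓ : ∀ n, ℓ.eval n = 2 * M.eval n * B.eval n := by simp [ℓ]
  have hDpos : ∀ n, 0 < D.eval n := fun n => by rw [hD]; positivity
  have hQpos : ∀ n, 0 < Q.eval n := fun n => by
    have := hDpos n
    rw [hQ]
    positivity
  have hMpos : ∀ n, 0 < M.eval n := fun n => by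
    have := hDpos n
    rw [hM]
    positivity
  clear_value ℓ
  let ι := Σ n : ℕ, Fin (ℓ.eval n) → Bool
  let par : ι → ℕ := fun i => i.1
  let inp : ι → QSim.Val := fun i => .pair (.num i.1) (.ofBits i.2)
  let num : ∀ n, (Fin (ℓ.eval n) → Bool) → ℤ := fun n ω => (C n).estimate (M.eval n) (B.eval n)
    (D.eval n) (s.eval n) (R n (Q.eval n)) (I n (Q.eval n)) ω
  have hself : QSim.PolyBounded par fun i => i.1 := .self par
  have hinp : QSim.Feasible par inp inp := by
    refine .input ((((QSim.PolyBounded.self par).add ((QSim.PolyBounded.const par 3).mul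
      (hself.eval ℓ))).add (.const par 3)).mono fun i => ?_)
    have h1 := QSim.size_ofBits_le i.2
    have h2 : Nat.size i.1 ≤ i.1 := Nat.size_le.2 Nat.lt_two_pow_self
    simp only [inp, par, QSim.Val.size]
    omega
  have hn : QSim.Feasible par inp fun i => .num i.1 := hinp.fst
  have hden : QSim.Feasible par inp fun i => .num ((M.eval i.1 * Q.eval i.1) ^ 2) := by
    simpa [pow_two] using ((hn.eval M).mul (hn.eval Q)).mul ((hn.eval M).mul (hn.eval Q))
  have hnum : QSim.Feasible par inp fun i => QSim.encInt (num i.1 i.2) :=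
    hC.feasible_estimate (n := par) (ℓ := fun n => ℓ.eval n) (M := fun n => M.eval n)
      (B := fun n => B.eval n) (D := fun n => D.eval n) (cap := fun n => s.eval n)
      (Q := fun n => Q.eval n) (ω := fun i => i.2) hRI hn hinp.snd (hn.eval M) (hself.eval M)
      (hn.eval B) (hself.eval B) (hn.eval D) (hn.eval s) (hself.eval s) (hn.eval Q) (hself.eval Q)
  obtain ⟨c, T, hc⟩ := QSim.Feasible.iff_runs.1 (hnum.pair hden)
  refine ⟨c, T, ℓ, fun n => ⟨fun ω => num n ω / ((M.eval n * Q.eval n) ^ 2 : ℕ), fun ω => ?_, ?_⟩⟩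
  · obtain ⟨t, ht, ht'⟩ := hc ⟨n, ω⟩
    have := hMpos n
    have := hQpos n
    refine ⟨_, t, ht, ht', (num n ω).toNat, (-num n ω).toNat, (M.eval n * Q.eval n) ^ 2,
      by positivity, rfl, ?_⟩
    have h : (num n ω : ℚ) = ((num n ω).toNat : ℚ) - ((-num n ω).toNat : ℚ) := by
      exact_mod_cast (by omega : num n ω = ((num n ω).toNat : ℤ) - ((-num n ω).toNat : ℤ))
    rw [← h]
  · have hgood : {ω : Fin (ℓ.eval n) → Bool | ¬ (C n).Accurate (M.eval n) (1 / (4 * D.eval n ^ 2))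
        (fun j => QSim.tableRow ω (B.eval n) (N n) (2 * j))
        fun j => QSim.tableRow ω (B.eval n) (N n) (2 * j + 1)}ᶜ ⊆
        {ω | |(((num n ω : ℚ) / ((M.eval n * Q.eval n) ^ 2 : ℕ) : ℚ) : ℝ) - (C n).expectation| ≤
          1 / (((p.eval n : ℕ) : ℝ) + 1)} := by
      intro ω hω
      have hω := not_not.1 hω
      have := (C n).abs_estimate_sub_expectation_le (hMpos n) (P := p.eval n + 1) (Nat.succ_pos _)
        (hs n) (hD n) (hQ n) (fun x => (hγ n _ x (hQpos n)).1) (fun x => (hγ n _ x (hQpos n)).2) hω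
      simpa [num] using this
    have hbad : (Set.ncard {ω : Fin (ℓ.eval n) → Bool | ¬ (C n).Accurate (M.eval n)
        (1 / (4 * D.eval n ^ 2)) (fun j => QSim.tableRow ω (B.eval n) (N n) (2 * j))
        fun j => QSim.tableRow ω (B.eval n) (N n) (2 * j + 1)} : ℝ) / 2 ^ ℓ.eval n ≤
        (1 / 2) ^ r.eval n := by
      rw [hℓ]
      exact (C n).card_not_accurate_le (hB n) (hDpos n) (hM n)
    refine le_trans ?_ (div_le_div_of_nonneg_right
      (Nat.cast_le.2 (Set.ncard_le_ncard hgood (Set.toFinite _))) (by positivity))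
    rw [Set.ncard_compl, Nat.cast_sub (Set.ncard_le_card _), sub_div]
    have hall : ((Nat.card (Fin (ℓ.eval n) → Bool) : ℕ) : ℝ) / 2 ^ ℓ.eval n = 1 := by
      simp
    rw [hall]
    linarith
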